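/- All Hilbert spaces are complex and separable, and projections are self-adjoint. For a unital algebra $\mathcal A$ of bounded operators on a Hilbert space $\mathcal H$, let $\mathrm{Lat}\,\mathcal A$ be the lattice of projections $L$ with $TL=LTL$ for all $T\in\mathcal A$. Call $\mathcal A$ a CDCSL algebra if it is reflexive (every operator leaving the range of each $L\in\mathrm{Lat}\,\mathcal A$ invariant belongs to $\mathcal A$), the projections in $\mathrm{Lat}\,\mathcal A$ commute, and $\mathrm{Lat}\,\mathcal A$ is completely distributive. Let $M(\mathrm{Lat}\,\mathcal A)$ be the partially ordered set of meet-irreducible elements of $\mathrm{Lat}\,\mathcal A$ other than $I$, with the topology generated by the sets $\{M : L\le M\}$, $L\in\mathrm{Lat}\,\mathcal A$, and their complements. A topological edge of a partially ordered topological space $X$ is a pair $(x,y)$ having neighbourhoods $U_x,U_y$ with $s\le t$ for all $s\in U_x$, $t\in U_y$. The topological complex of $X$ is the simplicial complex with vertex set $X$ whose simplices are the finite nonempty sets of points any two distinct elements of which are joined, in one direction or the other, by a topological edge. The spectral homology $H^{sp}_t(\mathcal A)$ is the integral simplicial homology $H_t$ of the topological complex of $M(\mathrm{Lat}\,\mathcal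 A)$. **Proposition 3.8.** Let $\mathcal A$ be a CDCSL algebra on $\mathcal H$, and let $\mathcal B_1,\mathcal B_2$ be type I factors acting on Hilbert spaces $\mathcal K_1,\mathcal K_2$ whose invariant projections commute (equivalently, $\mathcal B_i=\mathcal L(\mathcal K_i)$ and $\mathcal K_i\neq 0$). Let $$S\mathcal A=\begin{bmatrix}\mathcal B_1&0&*\\0&\mathcal B_2&*\\0&0&\mathcal A\end{bmatrix}$$ be the suspension of $\mathcal A$, acting on $\mathcal K_1\oplus\mathcal K_2\oplus\mathcal H$, where $*$ stands for arbitrary bounded operators. Then $S\mathcal A$ is a CDCSL algebra, and $M(\mathrm{Lat}\,S\mathcal A)$ is isomorphic, as a partially ordered topological space, to the two-point suspension of $M(\mathrm{Lat}\,\mathcal A)$, that is, to $M(\mathrm{Lat}\,\mathcal A)$ with two isolated, mutually incomparable points adjoined, both lying below every point of $M(\mathrm{Lat}\,\mathcal A)$. Moreover, $$H^{sp}_{t+1}(S\mathcal A)\cong H^{sp}_t(\mathcal A)\qquad (t\ge 1).$$ -/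

import Mathlib

noncomputable section

/-! ### Invariant projection lattices, CSL and CDCSL algebras

A self-adjoint projection on a Hilbert space is identified with its range, a closed subspace;
the order `P ≤ Q ↔ P * Q = P` of projections becomes inclusion of ranges. -/

section OperatorAlgebras

variable {H : Type*} [NormedAddCommGroup H] [InnerProductSpace ℂ H]

/-- The lattice of (ranges of) projections invariant under `A`, i.e. the closed subspaces `M` with
`T M ⊆ M` for all `T ∈ A`, as a complete sublattice of all closed subspaces (infima are
intersections, suprema are closed linear spans). -/
def invLattice (A : Subalgebra ℂ (H →L[ℂ] H)) : CompleteSublattice (ClosedSubmodule ℂ H) :=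
  CompleteSublattice.mk' {M | ∀ T ∈ A, ∀ x ∈ M, T x ∈ M}
    (by
      intro S hS T hT
      have h : sSup S ≤ (sSup S).comap T :=
        sSup_le fun M hM x hx => (le_sSup hM : M ≤ sSup S) (hS hM T hT x hx)
      exact fun x hx => h hx)
    (by
      intro S hS T hT x hx
      rw [ClosedSubmodule.mem_sInf] at hx ⊢
      exact fun M hM => hS hM T hT x (hx M hM))

/-- The projections in `Lat A` commute. -/
def InvProjectionsCommute [CompleteSpace H] (A : Subalgebra ℂ (H →L[ℂ] H)) : Prop :=
  ∀ M ∈ invLattice A, ∀ N ∈ invLattice A,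
    Commute M.toSubmodule.starProjection N.toSubmodule.starProjection

/-- `A = Alg Lat A`: an operator leaving every `A`-invariant closed subspace invariant is in `A`. -/
def IsReflexiveAlgebra (A : Subalgebra ℂ (H →L[ℂ] H)) : Prop :=
  ∀ T : H →L[ℂ] H, (∀ M ∈ invLattice A, ∀ x ∈ M, T x ∈ M) → T ∈ A

/-- A CSL algebra whose invariant projection lattice is completely distributive. -/
structure IsCDCSLAlgebra [CompleteSpace H] (A : Subalgebra ℂ (H →L[ℂ] H)) : Prop where
  reflexive : IsReflexiveAlgebra A
  commute : InvProjectionsCommute A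
  completelyDistributive : CompletelyDistribLattice.MinimalAxioms (invLattice A)

/-- Type I factors: von Neumann algebras with trivial centre which contain a minimal projection,
i.e. a projection `p ≠ 0` with `p B p = ℂ p`. -/
structure IsTypeIFactor [CompleteSpace H] (B : VonNeumannAlgebra H) : Prop where
  factor : ∀ T ∈ B, T ∈ B.commutant → ∃ c : ℂ, T = c • 1
  typeI : ∃ p ∈ B, IsStarProjection p ∧ p ≠ 0 ∧ ∀ T ∈ B, ∃ c : ℂ, p * T * p = c • p

/-- A von Neumann algebra as a unital algebra of operators. -/
abbrev VonNeumannAlgebra.toAlgebra [CompleteSpace H] (B : VonNeumannAlgebra H) :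
    Subalgebra ℂ (H →L[ℂ] H) :=
  B.toStarSubalgebra.toSubalgebra

end OperatorAlgebras

/-! ### The suspension of an operator algebra -/

section Suspension

variable {K₁ K₂ H : Type*}
  [NormedAddCommGroup K₁] [InnerProductSpace ℂ K₁] [CompleteSpace K₁]
  [NormedAddCommGroup K₂] [InnerProductSpace ℂ K₂] [CompleteSpace K₂]
  [NormedAddCommGroup H] [InnerProductSpace ℂ H]

/-- The Hilbert space direct sum `K₁ ⊕ K₂ ⊕ H`. -/
abbrev HilbertSum₃ (K₁ K₂ H : Type*) : Type _ := WithLp 2 (K₁ × WithLp 2 (K₂ × H))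

/-- The vector `k₁ ⊕ k₂ ⊕ h`. -/
def vec₃ (k₁ : K₁) (k₂ : K₂) (h : H) : HilbertSum₃ K₁ K₂ H :=
  WithLp.toLp 2 (k₁, WithLp.toLp 2 (k₂, h))

/-- The suspension: all operators on `K₁ ⊕ K₂ ⊕ H` with a block matrix
`[[b₁, 0, x], [0, b₂, y], [0, 0, a]]`, where `b₁ ∈ B₁`, `b₂ ∈ B₂`, `a ∈ A` and `x`, `y` are
arbitrary bounded operators. -/
def suspensionAlgebra (B₁ : VonNeumannAlgebra K₁) (B₂ : VonNeumannAlgebra K₂)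
    (A : Subalgebra ℂ (H →L[ℂ] H)) :
    Subalgebra ℂ (HilbertSum₃ K₁ K₂ H →L[ℂ] HilbertSum₃ K₁ K₂ H) where
  carrier := {T | ∃ b₁ ∈ B₁, ∃ b₂ ∈ B₂, ∃ a ∈ A, ∃ (x : H →L[ℂ] K₁) (y : H →L[ℂ] K₂),
    ∀ k₁ k₂ h, T (vec₃ k₁ k₂ h) = vec₃ (b₁ k₁ + x h) (b₂ k₂ + y h) (a h)}
  mul_mem' := by
    rintro S T ⟨b₁, hb₁, b₂, hb₂, a, ha, x, y, hS⟩ ⟨b₁', hb₁', b₂', hb₂', a', ha', x', y', hT⟩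
    refine ⟨b₁ * b₁', mul_mem hb₁ hb₁', b₂ * b₂', mul_mem hb₂ hb₂', a * a', mul_mem ha ha',
      b₁ ∘L x' + x ∘L a', b₂ ∘L y' + y ∘L a', fun k₁ k₂ h => ?_⟩
    simp [hS, hT, add_assoc]
  add_mem' := by
    rintro S T ⟨b₁, hb₁, b₂, hb₂, a, ha, x, y, hS⟩ ⟨b₁', hb₁', b₂', hb₂', a', ha', x', y', hT⟩
    refine ⟨b₁ + b₁', add_mem hb₁ hb₁', b₂ + b₂', add_mem hb₂ hb₂', a + a', add_mem ha ha',
      x + x', y + y', fun k₁ k₂ h => ?_⟩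
    rw [add_apply, hS, hT]
    simp only [vec₃, ← WithLp.toLp_add, Prod.mk_add_mk, add_apply]
    rw [add_add_add_comm (b₁ k₁), add_add_add_comm (b₂ k₂)]
  algebraMap_mem' := by
    intro c
    refine ⟨algebraMap ℂ _ c, B₁.toAlgebra.algebraMap_mem c, algebraMap ℂ _ c,
      B₂.toAlgebra.algebraMap_mem c, algebraMap ℂ _ c, A.algebraMap_mem c, 0, 0,
      fun k₁ k₂ h => ?_⟩
    simp [Algebra.algebraMap_eq_smul_one, vec₃, ← WithLp.toLp_smul]

end Suspension

/-! ### The meet-irreducible elements as a partially ordered topological space -/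

section MeetIrreducibles

variable {H : Type*} [NormedAddCommGroup H] [InnerProductSpace ℂ H]

/-- The set `M(Lat A)` of meet-irreducible invariant projections other than the identity
(`InfIrred` excludes the top element). -/
def MeetIrr (A : Subalgebra ℂ (H →L[ℂ] H)) : Type _ := {L : invLattice A // InfIrred L}

instance (A : Subalgebra ℂ (H →L[ℂ] H)) : PartialOrder (MeetIrr A) :=
  inferInstanceAs (PartialOrder {L : invLattice A // InfIrred L})

/-- The topology generated by the semi-intervals `[L, I)` and their complements, `L ∈ Lat A`. -/
instance (A : Subalgebra ℂ (H →L[ℂ] H)) : TopologicalSpace (MeetIrr A) :=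
  TopologicalSpace.generateFrom
    {U | ∃ L : invLattice A, U = {M : MeetIrr A | L ≤ M.1} ∨ U = {M : MeetIrr A | L ≤ M.1}ᶜ}

/-- The two-point suspension of a partially ordered space `X`: two incomparable points
`Sum.inl b` are adjoined to `X`, both below every point of `X`. -/
def TwoPointSuspension (X : Type*) : Type _ := Bool ⊕ X

/-- The adjoined points are isolated. -/
instance (X : Type*) [TopologicalSpace X] : TopologicalSpace (TwoPointSuspension X) :=
  inferInstanceAs (TopologicalSpace (Bool ⊕ X))

/-- The order relation of the two-point suspension. -/
def TwoPointSuspension.rel {X : Type*} [PartialOrder X] :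
    TwoPointSuspension X → TwoPointSuspension X → Prop
  | .inl a, .inl b => a = b
  | .inl _, .inr _ => True
  | .inr _, .inl _ => False
  | .inr x, .inr y => x ≤ y

instance (X : Type*) [PartialOrder X] : PartialOrder (TwoPointSuspension X) where
  le := TwoPointSuspension.rel
  le_refl := by rintro (a | x) <;> simp [TwoPointSuspension.rel]
  le_trans := by
    rintro (a | x) (b | y) (c | z) h₁ h₂ <;> simp_all only [TwoPointSuspension.rel]
    exact le_trans h₁ h₂
  le_antisymm := by
    rintro (a | x) (b | y) h₁ h₂
    · exact congrArg Sum.inl h₁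
    · exact h₂.elim
    · exact h₁.elim
    · exact congrArg Sum.inr (le_antisymm (α := X) h₁ h₂)

end MeetIrreducibles

/-! ### Integral simplicial homology -/

/-- An abstract simplicial complex on a partially ordered vertex set in which the vertices of each
face are totally ordered. -/
structure OrderedSimplicialComplex (V : Type*) [PartialOrder V] extends
    AbstractSimplicialComplex V where
  isChain : ∀ s ∈ faces, IsChain (· ≤ ·) (s : Set V)

namespace OrderedSimplicialComplex

variable {V : Type*} [PartialOrder V] (K : OrderedSimplicialComplex V)

/-- The `n`-simplices of `K`. Each face with `n + 1` vertices is listed exactly once, in increasing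
order, and this listing is its orientation. -/
def Simplex (n : ℕ) : Type _ := {v : Fin (n + 1) ↪o V // Finset.univ.map v.toEmbedding ∈ K.faces}

variable {K}

/-- The face of a simplex opposite its `i`-th vertex. -/
def Simplex.face {n : ℕ} (σ : K.Simplex (n + 1)) (i : Fin (n + 2)) : K.Simplex n :=
  ⟨(Fin.succAboveOrderEmb i).trans σ.1, by
    refine (K.isRelLowerSet_faces σ.2).2 (fun x hx => ?_) ?_
    · simp only [Finset.mem_map, Finset.mem_univ, true_and] at hx ⊢
      obtain ⟨j, rfl⟩ := hx
      exact ⟨i.succAbove j, rfl⟩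
    · exact Finset.univ_nonempty.map⟩

variable (K)

/-- The boundary `∂[v₀, …, vₙ₊₁] = ∑ᵢ (-1)ⁱ [v₀, …, v̂ᵢ, …, vₙ₊₁]` on the free abelian groups of
simplicial chains. -/
def boundary (n : ℕ) : (K.Simplex (n + 1) →₀ ℤ) →ₗ[ℤ] (K.Simplex n →₀ ℤ) :=
  Finsupp.linearCombination ℤ
    fun σ => ∑ i : Fin (n + 2), (-1 : ℤ) ^ (i : ℕ) • Finsupp.single (σ.face i) (1 : ℤ)

theorem Simplex.face_face {n : ℕ} (σ : K.Simplex (n + 2)) {i : Fin (n + 2)} {j : Fin (n + 3)}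
    (h : j ≤ i.castSucc) :
    (σ.face j).face i =
      (σ.face i.succ).face (j.castLT (lt_of_le_of_lt (Fin.le_def.1 h) i.2)) := by
  apply Subtype.ext
  apply RelEmbedding.ext
  intro k
  show σ.1 (j.succAbove (i.succAbove k)) = σ.1 (i.succ.succAbove ((j.castLT _).succAbove k))
  congr 1
  simp only [Fin.succAbove, Fin.ext_iff, Fin.lt_def, Fin.le_def] at h ⊢
  grind

theorem boundary_comp_boundary (n : ℕ) : K.boundary n ∘ₗ K.boundary (n + 1) = 0 := by
  apply Finsupp.lhom_ext'
  intro σ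
  apply LinearMap.ext_ring
  simp only [boundary, LinearMap.comp_apply, Finsupp.lsingle_apply,
    Finsupp.linearCombination_single, map_sum, map_smul, Finset.smul_sum, smul_smul,
    LinearMap.zero_apply]
  rw [← Finset.sum_product', Finset.univ_product_univ]
  let S : Finset (Fin (n + 3) × Fin (n + 2)) := {p | (p.1 : ℕ) ≤ (p.2 : ℕ)}
  rw [← Finset.sum_add_sum_compl S, ← eq_neg_iff_add_eq_zero, ← Finset.sum_neg_distrib]
  let φ : ∀ p : Fin (n + 3) × Fin (n + 2), p ∈ S → Fin (n + 3) × Fin (n + 2) := fun p hp =>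
    (p.2.succ, p.1.castLT (lt_of_le_of_lt (Finset.mem_filter.mp hp).right p.2.is_lt))
  apply Finset.sum_bij φ
  · intro p hp
    simp only [S, φ, Finset.compl_filter, Finset.mem_filter_univ, Fin.val_succ,
      Fin.val_castLT] at hp ⊢
    lia
  · rintro ⟨j, i⟩ hp ⟨j', i'⟩ hp' h
    simp only [φ, Prod.mk.injEq, Fin.ext_iff, Fin.val_succ, Fin.val_castLT] at h ⊢
    lia
  · rintro ⟨j', i'⟩ hp'
    simp only [S, Finset.compl_filter, Finset.mem_filter_univ, not_le] at hp'
    refine ⟨(i'.castSucc, j'.pred ?_), ?_, ?_⟩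
    · rintro rfl
      simp at hp'
    · simp only [S, Finset.mem_filter_univ, Fin.val_castSucc, Fin.val_pred]
      lia
    · simp [φ]
  · rintro ⟨j, i⟩ hp
    have hp' : j ≤ i.castSucc := by
      simpa [S, Fin.le_def] using hp
    simp only [φ, Simplex.face_face K σ hp', Fin.val_succ, Fin.val_castLT]
    rw [← neg_smul]
    congr 1
    ring

/-- The simplicial chain complex of `K` with integer coefficients. -/
def chainComplex : ChainComplex (ModuleCat ℤ) ℕ :=
  ChainComplex.of (fun n => ModuleCat.of ℤ (K.Simplex n →₀ ℤ))
    (fun n => ModuleCat.ofHom (K.boundary n)) fun n => by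
      rw [← ModuleCat.ofHom_comp, K.boundary_comp_boundary]; rfl

/-- The integral simplicial homology groups of `K`. -/
def simplicialHomology (n : ℕ) : ModuleCat ℤ := K.chainComplex.homology n

end OrderedSimplicialComplex

/-! ### Point-neighbourhood homology and spectral homology -/

section PointNeighbourhood

open Topology

variable (X : Type*) [TopologicalSpace X] [PartialOrder X]

variable {X} in
/-- `(x, y)` is a topological edge: `x` and `y` have neighbourhoods `U`, `V` with `s ≤ t` for all
`s ∈ U` and `t ∈ V`. -/
def IsTopEdge (x y : X) : Prop := ∃ U ∈ 𝓝 x, ∃ V ∈ 𝓝 y, ∀ s ∈ U, ∀ t ∈ V, s ≤ t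

variable {X} in
theorem IsTopEdge.le {x y : X} (h : IsTopEdge x y) : x ≤ y := by
  obtain ⟨U, hU, V, hV, h⟩ := h
  exact h x (mem_of_mem_nhds hU) y (mem_of_mem_nhds hV)

/-- The undirected graph of topological edges. -/
def topEdgeGraph : SimpleGraph X where
  Adj x y := x ≠ y ∧ (IsTopEdge x y ∨ IsTopEdge y x)
  symm := ⟨fun _ _ h => ⟨h.1.symm, h.2.symm⟩⟩
  loopless := ⟨fun _ h => h.1 rfl⟩

/-- The topological complex of `X`: its faces are the vertex sets of the finite nonempty complete
subgraphs of the graph of topological edges. -/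
def topComplex : OrderedSimplicialComplex X where
  faces := {s | s.Nonempty ∧ (topEdgeGraph X).IsClique (s : Set X)}
  isRelLowerSet_faces := fun _ hs =>
    ⟨hs.1, fun _ hts ht => ⟨ht, hs.2.subset (Finset.coe_subset.2 hts)⟩⟩
  singleton_mem v := by simp
  isChain _ hs _ hx _ hy hxy := (hs.2 hx hy hxy).2.imp IsTopEdge.le IsTopEdge.le

/-- The point-neighbourhood homology `H_t(X)`: the integral simplicial homology of the topological
complex of `X`. -/
def pointNbhdHomology (t : ℕ) : ModuleCat ℤ := (topComplex X).simplicialHomology t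

end PointNeighbourhood

/-- The spectral homology `H_t^{sp}(A)`: the point-neighbourhood homology of `M(Lat A)`. -/
def spectralHomology {H : Type*} [NormedAddCommGroup H] [InnerProductSpace ℂ H]
    (A : Subalgebra ℂ (H →L[ℂ] H)) (t : ℕ) : ModuleCat ℤ :=
  pointNbhdHomology (MeetIrr A) t

end

/-! A type I factor with commuting invariant projections is all of L(K)
(`IsTypeIFactor.mem_of_commute`): vectors in the range of a minimal projection generate cyclic
subspaces whose projections commute only if that range is a line, and this makes the commutant
scalar. The suspension therefore contains the diagonal projections, all operators on K₁ and on K₂,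
and all operators from H to K₁ and K₂. Its invariant subspaces split as M₁ ⊕ M₂ ⊕ M₃ with M₁, M₂
trivial, and M₃ ≠ 0 forces M₁, M₂ to be full (`exists_eq_sum₃_of_mem_invLattice`). So the new
lattice is Lat A, sitting as K₁ ⊕ K₂ ⊕ L, with the atoms K₁, K₂ and the zero subspace placed
underneath.

The rest is formal. Such a lattice embeds in Prop × Prop × Lat A with all infima and suprema
preserved, so it stays completely distributive. Its bottom is the meet of the two atoms, the atoms
are meet-irreducible, and irreducibility above them is that of Lat A; each atom is isolated as a
difference of subbasic clopen sets. An isolated point below everything is joined by a topological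
edge to every old point, while the two new points are not joined, so the topological complex becomes
its simplicial suspension (`topComplex_isSuspension`). Its chains in degree n + 1 are two copies of
the old n-chains (the cones) and the old (n + 1)-chains, and the difference of the two cones on a
cycle induces the homology isomorphism. -/

noncomputable section

/-! ### Homology of an algebraic suspension -/

/-- The homology `ker g / im f` of a pair of composable linear maps. -/
abbrev homologyQuotient {R M₁ M₂ M₃ : Type*} [Ring R] [AddCommGroup M₁] [AddCommGroup M₂]
    [AddCommGroup M₃] [Module R M₁] [Module R M₂] [Module R M₃] (f : M₁ →ₗ[R] M₂)
    (g : M₂ →ₗ[R] M₃) : Type _ :=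
  g.ker ⧸ f.range.submoduleOf g.ker

section AlgebraicSuspension

variable {R : Type*} [Ring R] {C D : ℕ → Type*} [∀ n, AddCommGroup (C n)] [∀ n, Module R (C n)]
  [∀ n, AddCommGroup (D n)] [∀ n, Module R (D n)]

/-- If a complex `D` is the sum of a complex `C` and of two cones over it (with bases identified),
then the homology of `D` is that of `C` with a degree shift. -/
theorem nonempty_homologyQuotient_equiv_of_suspension
    (dC : ∀ n, C (n + 1) →ₗ[R] C n) (dD : ∀ n, D (n + 1) →ₗ[R] D n)
    (incl : ∀ n, C n →ₗ[R] D n) (cone : Bool → ∀ n, C n →ₗ[R] D (n + 1))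
    (hincl : ∀ n x, dD n (incl (n + 1) x) = incl n (dC n x))
    (hcone : ∀ b n x, dD (n + 1) (cone b (n + 1) x) = incl (n + 1) x - cone b n (dC n x))
    (hsurj : ∀ n z, ∃ x y w, z = cone true n x + cone false n y + incl (n + 1) w)
    (hinj : ∀ n x y w, cone true n x + cone false n y + incl (n + 1) w = 0 →
      x = 0 ∧ y = 0 ∧ w = 0) (n : ℕ) :
    Nonempty (homologyQuotient (dD (n + 1 + 1)) (dD (n + 1)) ≃ₗ[R]
      homologyQuotient (dC (n + 1)) (dC n)) := by
  -- On a cycle `x` both cones have boundary `incl x`, so their difference is a cycle.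
  let φ : (dC n).ker →ₗ[R] (dD (n + 1)).ker :=
    (cone true (n + 1) - cone false (n + 1)).restrict fun x hx => by
      rw [LinearMap.mem_ker] at hx ⊢
      simp [hcone, hx]
  have hφ (x) : (φ x : D (n + 1 + 1)) = cone true (n + 1) x - cone false (n + 1) x := rfl
  have hmap : (dC (n + 1)).range.submoduleOf (dC n).ker ≤
      ((dD (n + 1 + 1)).range.submoduleOf (dD (n + 1)).ker).comap φ := by
    rintro ⟨x, hx⟩ ⟨w, hw⟩
    refine ⟨cone false _ w - cone true _ w, ?_⟩
    rw [map_sub, hcone, hcone, hw, Submodule.subtype_apply, Submodule.subtype_apply, hφ]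
    abel
  refine ⟨(LinearEquiv.ofBijective (Submodule.mapQ _ _ φ hmap) ⟨?_, ?_⟩).symm⟩
  · rw [injective_iff_map_eq_zero]
    intro q
    obtain ⟨⟨x, hx⟩, rfl⟩ := Submodule.Quotient.mk_surjective _ q
    rw [Submodule.mapQ_apply, Submodule.Quotient.mk_eq_zero, Submodule.Quotient.mk_eq_zero]
    rintro ⟨z, hz⟩
    obtain ⟨a, b, c, rfl⟩ := hsurj _ z
    rw [map_add, map_add, hcone, hcone, hincl, Submodule.subtype_apply, hφ] at hz
    -- Comparing components in `dD z = φ x`: the `true` cone gives `dC a + x = 0`, so `x` is the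
    -- boundary of `-a`.
    have key := hinj (n + 1) (dC _ a + x) (dC _ b - x) (-(a + b + dC _ c)) (by
      have h := sub_eq_zero.2 hz
      simp only [map_add, map_sub, map_neg]
      rw [← neg_eq_zero, ← h]
      simp only
      abel)
    refine ⟨-a, ?_⟩
    rw [map_neg, Submodule.subtype_apply]
    exact (eq_neg_of_add_eq_zero_right key.1).symm
  · intro q
    obtain ⟨⟨z, hz⟩, rfl⟩ := Submodule.Quotient.mk_surjective _ q
    obtain ⟨a, b, c, rfl⟩ := hsurj _ z
    rw [LinearMap.mem_ker, map_add, map_add, hcone, hcone, hincl] at hz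
    obtain ⟨ha, hb, hab⟩ := hinj n (-dC n a) (-dC n b) (a + b + dC _ c) (by
      rw [← hz]
      simp only [map_add, map_neg]
      abel)
    -- Since `b = -a - dC c`, the cycle `z` equals `φ a` plus the boundary of `cone false c`.
    refine ⟨Submodule.Quotient.mk ⟨a, neg_eq_zero.1 ha⟩, ?_⟩
    rw [Submodule.mapQ_apply, Submodule.Quotient.eq]
    refine ⟨-cone false _ c, ?_⟩
    have hb' : b = -a - dC _ c := by
      rw [← sub_eq_zero, ← hab]
      abel
    rw [map_neg, hcone, Submodule.subtype_apply, AddSubgroupClass.coe_sub, hφ]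
    subst hb'
    simp only [map_sub, map_neg]
    abel

end AlgebraicSuspension

/-! ### Simplicial homology in positive degree as kernel modulo image. -/

namespace OrderedSimplicialComplex

open CategoryTheory

variable {V : Type*} [PartialOrder V]

theorem nonempty_simplicialHomology_equiv (K : OrderedSimplicialComplex V) (n : ℕ) :
    Nonempty (K.simplicialHomology (n + 1) ≃ₗ[ℤ]
      homologyQuotient (K.boundary (n + 1)) (K.boundary n)) := by
  let S : ShortComplex (ModuleCat ℤ) := ShortComplex.moduleCatMk (K.boundary (n + 1))
    (K.boundary n) (K.boundary_comp_boundary n)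
  let e₁ : K.chainComplex.sc (n + 1) ≅ K.chainComplex.sc' (n + 1 + 1) (n + 1) n :=
    K.chainComplex.isoSc' _ _ _ (by simp) (by simp)
  let e₂ : K.chainComplex.sc' (n + 1 + 1) (n + 1) n ≅ S :=
    ShortComplex.isoMk (Iso.refl _) (Iso.refl _) (Iso.refl _)
      (by simp [S, chainComplex]; rfl) (by simp [S, chainComplex]; rfl)
  refine ⟨((ShortComplex.homologyMapIso (e₁ ≪≫ e₂)) ≪≫ S.moduleCatHomologyIso).toLinearEquiv ≪≫ₗ
    Submodule.quotEquivOfEq _ _ ?_⟩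
  -- One quotient is by the range of the map into the cycles, the other by the trace of the image on
  -- the cycles.
  ext x
  constructor
  · rintro ⟨y, rfl⟩
    exact ⟨y, rfl⟩
  · rintro ⟨y, hy⟩
    exact ⟨y, Subtype.ext hy⟩

end OrderedSimplicialComplex

/-! ### The suspension of an ordered simplicial complex -/

namespace OrderedSimplicialComplex

variable {V W : Type*} [PartialOrder V] [PartialOrder W] {K : OrderedSimplicialComplex V}
  {L : OrderedSimplicialComplex W}

@[ext]
theorem Simplex.ext {n : ℕ} {σ τ : K.Simplex n} (h : ∀ i, σ.1 i = τ.1 i) : σ = τ :=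
  Subtype.ext (RelEmbedding.ext h)

theorem boundary_single (n : ℕ) (σ : K.Simplex (n + 1)) :
    K.boundary n (Finsupp.single σ 1) =
      ∑ i : Fin (n + 2), (-1 : ℤ) ^ (i : ℕ) • Finsupp.single (σ.face i) (1 : ℤ) := by
  simp [boundary]

/-- `L` is the simplicial suspension of `K`: its vertices are two incomparable apexes `apex b` and
the vertices of `K`, embedded by `base`, and its faces of dimension at least one are those of `K`
and the cones over faces of `K`. -/
structure IsSuspension (K : OrderedSimplicialComplex V) (L : OrderedSimplicialComplex W)
    (apex : Bool → W) (base : V ↪o W) : Prop where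
  apex_lt_base : ∀ b v, apex b < base v
  eq_of_apex_le : ∀ b c, apex b ≤ apex c → b = c
  cover : ∀ w, (∃ b, apex b = w) ∨ ∃ v, base v = w
  map_mem_iff : ∀ s : Finset V, s.map base.toEmbedding ∈ L.faces ↔ s ∈ K.faces
  cons_mem : ∀ b, ∀ s ∈ K.faces, ∀ h, Finset.cons (apex b) (s.map base.toEmbedding) h ∈ L.faces

namespace IsSuspension

variable {apex : Bool → W} {base : V ↪o W} (h : IsSuspension K L apex base)

include h

/-- A simplex of `K` as a simplex of the suspension. -/
def incl {n : ℕ} (σ : K.Simplex n) : L.Simplex n :=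
  ⟨σ.1.trans base, by
    have := (h.map_mem_iff _).2 σ.2
    rwa [Finset.map_map] at this⟩

theorem strictMono_cons (b : Bool) {n : ℕ} (σ : K.Simplex n) :
    StrictMono (Fin.cons (apex b) fun i => base (σ.1 i) : Fin (n + 2) → W) := by
  intro i k hik
  induction k using Fin.cases with
  | zero => exact absurd hik (Fin.not_lt_zero i)
  | succ k =>
    induction i using Fin.cases with
    | zero => simpa using h.apex_lt_base b _
    | succ i => simpa using hik

/-- The cone over a simplex of `K`, as a simplex of the suspension. -/
def cone (b : Bool) {n : ℕ} (σ : K.Simplex n) : L.Simplex (n + 1) :=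
  ⟨OrderEmbedding.ofStrictMono _ (h.strictMono_cons b σ), by
    have hb : apex b ∉ (Finset.univ.map σ.1.toEmbedding).map base.toEmbedding := by
      simp only [Finset.mem_map, not_exists, not_and]
      exact fun v _ hv => (h.apex_lt_base b v).ne' hv
    convert h.cons_mem b _ σ.2 hb using 1
    ext w
    simp [Fin.exists_fin_succ, eq_comm]⟩

@[simp] theorem incl_apply {n : ℕ} (σ : K.Simplex n) (i) : (h.incl σ).1 i = base (σ.1 i) := rfl

@[simp] theorem cone_zero (b : Bool) {n : ℕ} (σ : K.Simplex n) : (h.cone b σ).1 0 = apex b := rfl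

@[simp] theorem cone_succ (b : Bool) {n : ℕ} (σ : K.Simplex n) (i : Fin (n + 1)) :
    (h.cone b σ).1 i.succ = base (σ.1 i) := rfl

theorem incl_face {n : ℕ} (σ : K.Simplex (n + 1)) (i) :
    (h.incl σ).face i = h.incl (σ.face i) := rfl

theorem cone_face_zero (b : Bool) {n : ℕ} (σ : K.Simplex n) :
    (h.cone b σ).face 0 = h.incl σ := rfl

theorem cone_face_succ (b : Bool) {n : ℕ} (σ : K.Simplex (n + 1)) (i : Fin (n + 2)) :
    (h.cone b σ).face i.succ = h.cone b (σ.face i) := by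
  ext k
  induction k using Fin.cases with
  | zero => rfl
  | succ k =>
    change (h.cone b σ).1 (i.succ.succAbove k.succ) = base (σ.1 (i.succAbove k))
    rw [Fin.succ_succAbove_succ, cone_succ]

theorem incl_injective (n : ℕ) : Function.Injective (h.incl (n := n)) := fun σ τ hστ =>
  Simplex.ext fun i => base.injective (by rw [← h.incl_apply, hστ, h.incl_apply])

theorem cone_injective (b : Bool) (n : ℕ) : Function.Injective (h.cone b (n := n)) :=
  fun σ τ hστ => Simplex.ext fun i => base.injective (by
    rw [← h.cone_succ b, hστ, h.cone_succ b])

theorem cone_ne_incl (b : Bool) {n : ℕ} (σ : K.Simplex n) (τ : K.Simplex (n + 1)) :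
    h.cone b σ ≠ h.incl τ := fun hστ =>
  (h.apex_lt_base b (τ.1 0)).ne (by rw [← h.cone_zero b σ, hστ, h.incl_apply])

theorem cone_ne_cone {b c : Bool} (hbc : b ≠ c) {n : ℕ} (σ τ : K.Simplex n) :
    h.cone b σ ≠ h.cone c τ := fun hστ =>
  hbc (h.eq_of_apex_le b c (by rw [← h.cone_zero b σ, hστ, h.cone_zero]))

theorem exists_incl_eq {n : ℕ} (τ : L.Simplex n) (hτ : ∀ i, ∃ v, base v = τ.1 i) :
    ∃ σ, h.incl σ = τ := by
  choose v hv using hτ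
  have hmono : StrictMono v := fun i k hik => by
    rw [← base.lt_iff_lt, hv, hv]
    exact τ.1.strictMono hik
  have hmap : (Finset.univ.map (OrderEmbedding.ofStrictMono v hmono).toEmbedding).map
      base.toEmbedding = Finset.univ.map τ.1.toEmbedding := by
    ext w
    simp [hv]
  exact ⟨⟨OrderEmbedding.ofStrictMono v hmono, (h.map_mem_iff _).1 (hmap ▸ τ.2)⟩,
    Simplex.ext hv⟩

/-- Nothing lies strictly below an apex, so only the initial vertex of a simplex can be one. -/
theorem exists_base_eq_succ {n : ℕ} (τ : L.Simplex (n + 1)) (i : Fin (n + 1)) :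
    ∃ v, base v = τ.1 i.succ := by
  have hlt : τ.1 0 < τ.1 i.succ := τ.1.strictMono i.succ_pos
  refine (h.cover (τ.1 i.succ)).resolve_left ?_
  rintro ⟨c, hc⟩
  rw [← hc] at hlt
  rcases h.cover (τ.1 0) with ⟨b, hb⟩ | ⟨v, hv⟩
  · rw [← hb] at hlt
    exact hlt.ne (congrArg apex (h.eq_of_apex_le b c hlt.le))
  · rw [← hv] at hlt
    exact lt_asymm hlt (h.apex_lt_base c v)

theorem exists_cone_or_incl {n : ℕ} (τ : L.Simplex (n + 1)) :
    (∃ b σ, h.cone b σ = τ) ∨ ∃ σ, h.incl σ = τ := by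
  rcases h.cover (τ.1 0) with ⟨b, hb⟩ | h₀
  · obtain ⟨σ, hσ⟩ := h.exists_incl_eq (τ.face 0) (h.exists_base_eq_succ τ)
    refine Or.inl ⟨b, σ, Simplex.ext fun i => ?_⟩
    induction i using Fin.cases with
    | zero => exact hb
    | succ i => exact congrArg (fun ρ : L.Simplex n => ρ.1 i) hσ
  · exact Or.inr (h.exists_incl_eq τ (Fin.cases h₀ (h.exists_base_eq_succ τ)))

theorem boundary_incl (n : ℕ) (x : K.Simplex (n + 1) →₀ ℤ) :
    L.boundary n (Finsupp.lmapDomain ℤ ℤ h.incl x) =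
      Finsupp.lmapDomain ℤ ℤ h.incl (K.boundary n x) := by
  refine LinearMap.congr_fun (f := L.boundary n ∘ₗ Finsupp.lmapDomain ℤ ℤ h.incl)
    (g := Finsupp.lmapDomain ℤ ℤ h.incl ∘ₗ K.boundary n) (Finsupp.lhom_ext' fun σ => ?_) x
  apply LinearMap.ext_ring
  simp only [LinearMap.comp_apply, Finsupp.lsingle_apply, Finsupp.lmapDomain_apply,
    Finsupp.mapDomain_single, boundary_single, incl_face]
  rw [← Finsupp.lmapDomain_apply ℤ ℤ, map_sum]
  simp

/-- The apex is the vertex numbered 0: deleting it leaves the base with sign +1, and deleting vertex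
i + 1 leaves the cone over the i-th face, with one extra sign. -/
theorem boundary_cone (b : Bool) (n : ℕ) (x : K.Simplex (n + 1) →₀ ℤ) :
    L.boundary (n + 1) (Finsupp.lmapDomain ℤ ℤ (h.cone b) x) =
      Finsupp.lmapDomain ℤ ℤ h.incl x - Finsupp.lmapDomain ℤ ℤ (h.cone b) (K.boundary n x) := by
  refine LinearMap.congr_fun (f := L.boundary (n + 1) ∘ₗ Finsupp.lmapDomain ℤ ℤ (h.cone b))
    (g := Finsupp.lmapDomain ℤ ℤ h.incl - Finsupp.lmapDomain ℤ ℤ (h.cone b) ∘ₗ K.boundary n)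
    (Finsupp.lhom_ext' fun σ => ?_) x
  apply LinearMap.ext_ring
  simp only [LinearMap.comp_apply, LinearMap.sub_apply, Finsupp.lsingle_apply,
    Finsupp.lmapDomain_apply, Finsupp.mapDomain_single, boundary_single]
  rw [← Finsupp.lmapDomain_apply ℤ ℤ (h.cone b) (∑ i, _), map_sum, Fin.sum_univ_succ,
    cone_face_zero, sub_eq_add_neg, ← Finset.sum_neg_distrib]
  simp [cone_face_succ, pow_succ]

theorem exists_cone_add_incl (n : ℕ) (z : L.Simplex (n + 1) →₀ ℤ) : ∃ x y w,
    z = Finsupp.lmapDomain ℤ ℤ (h.cone true) x + Finsupp.lmapDomain ℤ ℤ (h.cone false) y +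
      Finsupp.lmapDomain ℤ ℤ h.incl w := by
  induction z using Finsupp.induction_linear with
  | zero => exact ⟨0, 0, 0, by simp⟩
  | add z z' hz hz' =>
    obtain ⟨x, y, w, rfl⟩ := hz
    obtain ⟨x', y', w', rfl⟩ := hz'
    refine ⟨x + x', y + y', w + w', ?_⟩
    simp only [map_add]
    abel
  | single τ a =>
    rcases h.exists_cone_or_incl τ with ⟨b, σ, rfl⟩ | ⟨σ, rfl⟩
    · cases b
      · exact ⟨0, Finsupp.single σ a, 0, by simp⟩
      · exact ⟨Finsupp.single σ a, 0, 0, by simp⟩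
    · exact ⟨0, 0, Finsupp.single σ a, by simp⟩

/-- The three families of simplices are injectively parametrized and pairwise disjoint, so each
coefficient can be read off by evaluating at one simplex. -/
theorem eq_zero_of_cone_add_incl (n : ℕ) (x y : K.Simplex n →₀ ℤ) (w : K.Simplex (n + 1) →₀ ℤ)
    (hz : Finsupp.lmapDomain ℤ ℤ (h.cone true) x + Finsupp.lmapDomain ℤ ℤ (h.cone false) y +
      Finsupp.lmapDomain ℤ ℤ h.incl w = 0) : x = 0 ∧ y = 0 ∧ w = 0 := by
  simp only [Finsupp.lmapDomain_apply] at hz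
  refine ⟨Finsupp.ext fun σ => ?_, Finsupp.ext fun σ => ?_, Finsupp.ext fun σ => ?_⟩
  · have := DFunLike.congr_fun hz (h.cone true σ)
    rwa [Finsupp.add_apply, Finsupp.add_apply, Finsupp.mapDomain_apply (h.cone_injective true n),
      Finsupp.mapDomain_of_notMem_range _ _ (by
        rintro ⟨τ, hτ⟩; exact h.cone_ne_cone (by decide) _ _ hτ),
      Finsupp.mapDomain_of_notMem_range _ _ (by
        rintro ⟨τ, hτ⟩; exact h.cone_ne_incl _ _ _ hτ.symm), add_zero, add_zero] at this
  · have := DFunLike.congr_fun hz (h.cone false σ)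
    rwa [Finsupp.add_apply, Finsupp.add_apply, Finsupp.mapDomain_apply (h.cone_injective false n),
      Finsupp.mapDomain_of_notMem_range _ _ (by
        rintro ⟨τ, hτ⟩; exact h.cone_ne_cone (by decide) _ _ hτ),
      Finsupp.mapDomain_of_notMem_range _ _ (by
        rintro ⟨τ, hτ⟩; exact h.cone_ne_incl _ _ _ hτ.symm), add_zero, zero_add] at this
  · have := DFunLike.congr_fun hz (h.incl σ)
    rwa [Finsupp.add_apply, Finsupp.add_apply, Finsupp.mapDomain_apply (h.incl_injective _),
      Finsupp.mapDomain_of_notMem_range _ _ (by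
        rintro ⟨τ, hτ⟩; exact h.cone_ne_incl _ _ _ hτ),
      Finsupp.mapDomain_of_notMem_range _ _ (by
        rintro ⟨τ, hτ⟩; exact h.cone_ne_incl _ _ _ hτ), zero_add, zero_add] at this

/-- The suspension isomorphism in integral simplicial homology. -/
theorem nonempty_simplicialHomology_equiv (n : ℕ) :
    Nonempty (L.simplicialHomology (n + 1 + 1) ≃ₗ[ℤ] K.simplicialHomology (n + 1)) := by
  obtain ⟨e₁⟩ := L.nonempty_simplicialHomology_equiv (n + 1)
  obtain ⟨e₂⟩ := K.nonempty_simplicialHomology_equiv n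
  obtain ⟨e⟩ := nonempty_homologyQuotient_equiv_of_suspension
    (C := fun n => K.Simplex n →₀ ℤ) (D := fun n => L.Simplex n →₀ ℤ) K.boundary L.boundary
    (fun n => Finsupp.lmapDomain ℤ ℤ h.incl) (fun b n => Finsupp.lmapDomain ℤ ℤ (h.cone b))
    h.boundary_incl h.boundary_cone h.exists_cone_add_incl h.eq_zero_of_cone_add_incl n
  exact ⟨e₁ ≪≫ₗ e ≪≫ₗ e₂.symm⟩

end IsSuspension

end OrderedSimplicialComplex

/-! ### The topological complex of a two-point suspension -/

section TopologicalComplex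

open Topology

variable {X Y : Type*} [TopologicalSpace X] [PartialOrder X] [TopologicalSpace Y] [PartialOrder Y]

namespace TwoPointSuspension

variable (X) in
/-- The adjoined points of the two-point suspension. -/
def apex (b : Bool) : TwoPointSuspension X := Sum.inl b

/-- The inclusion of a space into its two-point suspension. -/
def base : X ↪o TwoPointSuspension X where
  toFun := Sum.inr
  inj' := Sum.inr_injective
  map_rel_iff' := Iff.rfl

omit [TopologicalSpace X] in
theorem apex_lt_base (b : Bool) (x : X) : apex X b < base x :=
  lt_of_le_not_ge (show rel (.inl b) (.inr x) from trivial)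
    (show ¬ rel (.inr x) (.inl b) from id)

omit [TopologicalSpace X] in
theorem eq_of_apex_le {b c : Bool} (h : apex X b ≤ apex X c) : b = c := h

theorem nhds_base (x : X) : 𝓝 (base x) = (𝓝 x).map base := nhds_inr x

omit [PartialOrder X] in
theorem nhds_apex (b : Bool) : 𝓝 (apex X b) = pure (apex X b) :=
  (nhds_inl b).trans (by rw [nhds_discrete, Filter.map_pure]; rfl)

theorem isTopEdge_base_iff {x y : X} : IsTopEdge (base x) (base y) ↔ IsTopEdge x y := by
  simp only [IsTopEdge, nhds_base, Filter.mem_map]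
  constructor
  · rintro ⟨U, hU, V, hV, h⟩
    exact ⟨_, hU, _, hV, fun s hs t ht => base.le_iff_le.1 (h _ hs _ ht)⟩
  · rintro ⟨U, hU, V, hV, h⟩
    refine ⟨base '' U, ?_, base '' V, ?_, ?_⟩
    · rwa [Set.preimage_image_eq _ base.injective]
    · rwa [Set.preimage_image_eq _ base.injective]
    · rintro _ ⟨s, hs, rfl⟩ _ ⟨t, ht, rfl⟩
      exact base.le_iff_le.2 (h s hs t ht)

/-- The apex is isolated and the whole copy of `X` is a neighbourhood of each of its points. -/
theorem isTopEdge_apex_base (b : Bool) (x : X) : IsTopEdge (apex X b) (base x) := by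
  refine ⟨{apex X b}, ?_, Set.range base, ?_, ?_⟩
  · rw [nhds_apex]
    exact Set.mem_singleton _
  · rw [nhds_base]
    exact Filter.range_mem_map
  · rintro _ rfl _ ⟨t, rfl⟩
    exact (apex_lt_base b t).le

end TwoPointSuspension

theorem IsTopEdge.of_orderIso (e : X ≃o Y) (he : IsHomeomorph e) {x y : X}
    (h : IsTopEdge (e x) (e y)) : IsTopEdge x y := by
  obtain ⟨U, hU, V, hV, h⟩ := h
  exact ⟨e ⁻¹' U, he.continuous.continuousAt hU, e ⁻¹' V, he.continuous.continuousAt hV,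
    fun s hs t ht => e.le_iff_le.1 (h _ hs _ ht)⟩

theorem isTopEdge_orderIso_iff (e : X ≃o Y) (he : IsHomeomorph e) {x y : X} :
    IsTopEdge (e x) (e y) ↔ IsTopEdge x y := by
  refine ⟨.of_orderIso e he, fun h => .of_orderIso e.symm ?_ (by simpa using h)⟩
  have hsymm : ⇑e.symm = (he.homeomorph e).symm :=
    funext fun y => e.symm_apply_eq.2 ((he.homeomorph e).apply_symm_apply y).symm
  exact hsymm ▸ (he.homeomorph e).symm.isHomeomorph

open TwoPointSuspension in
theorem isClique_map_iff (e : TwoPointSuspension X ≃o Y) (he : IsHomeomorph e) (s : Finset X) :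
    (topEdgeGraph Y).IsClique (s.map (base.trans e.toOrderEmbedding).toEmbedding : Set Y) ↔
      (topEdgeGraph X).IsClique (s : Set X) := by
  have hadj (x y : X) : (topEdgeGraph Y).Adj (e (base x)) (e (base y)) ↔
      (topEdgeGraph X).Adj x y := by
    simp [topEdgeGraph, isTopEdge_orderIso_iff e he, isTopEdge_base_iff]
  rw [Finset.coe_map, SimpleGraph.isClique_iff, SimpleGraph.isClique_iff,
    (Function.Embedding.injective _).injOn.pairwise_image]
  exact forall₅_congr fun x _ y _ _ => hadj x y

open TwoPointSuspension in
/-- The topological complex of a two-point suspension is the simplicial suspension. -/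
theorem topComplex_isSuspension (e : TwoPointSuspension X ≃o Y) (he : IsHomeomorph e) :
    (topComplex X).IsSuspension (topComplex Y) (fun b => e (apex X b))
      (base.trans e.toOrderEmbedding) where
  apex_lt_base b x := e.lt_iff_lt.2 (apex_lt_base b x)
  eq_of_apex_le b c h := eq_of_apex_le (e.le_iff_le.1 h)
  cover y := by
    obtain ⟨b | x, rfl⟩ := e.surjective y
    · exact Or.inl ⟨b, rfl⟩
    · exact Or.inr ⟨x, rfl⟩
  map_mem_iff s := and_congr Finset.map_nonempty (isClique_map_iff e he s)
  cons_mem b s hs hb := by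
    refine ⟨Finset.cons_nonempty hb, ?_⟩
    rw [Finset.coe_cons, SimpleGraph.isClique_insert]
    refine ⟨(isClique_map_iff e he s).2 hs.2, fun w hw hne => ⟨hne, Or.inl ?_⟩⟩
    obtain ⟨x, -, rfl⟩ := Finset.mem_map.1 hw
    exact (isTopEdge_orderIso_iff e he).2 (isTopEdge_apex_base b x)

/-- Degree 0 is left out because the homology is not reduced. -/
theorem nonempty_pointNbhdHomology_equiv (e : TwoPointSuspension X ≃o Y) (he : IsHomeomorph e)
    {t : ℕ} (ht : 1 ≤ t) :
    Nonempty (pointNbhdHomology Y (t + 1) ≃ₗ[ℤ] pointNbhdHomology X t) := by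
  obtain ⟨t, rfl⟩ := Nat.exists_eq_add_of_le' ht
  exact (topComplex_isSuspension e he).nonempty_simplicialHomology_equiv t

end TopologicalComplex

/-! ### The suspension of a complete lattice -/

section LatticeSuspension

variable {Λ Λ' : Type*} [CompleteLattice Λ] [CompleteLattice Λ']

/-- `Λ'` is obtained from `Λ` by adjoining below the bottom element of `Λ` two incomparable atoms
`atom b` and a new bottom element. -/
structure IsLatticeSuspension (atom : Bool → Λ') (upper : Λ ↪o Λ') : Prop where
  atom_le_upper : ∀ b L, atom b ≤ upper L
  eq_of_atom_le : ∀ b c, atom b ≤ atom c → b = c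
  cover : ∀ x, x = ⊥ ∨ (∃ b, x = atom b) ∨ ∃ L, x = upper L

namespace IsLatticeSuspension

variable {atom : Bool → Λ'} {upper : Λ ↪o Λ'} (h : IsLatticeSuspension atom upper)

include h

theorem atom_ne_bot (b : Bool) : atom b ≠ ⊥ := fun hb => by
  have := h.eq_of_atom_le b (!b) (hb ▸ bot_le)
  simp at this

/-- Otherwise the other atom, being below `upper L`, would lie below `atom b`. -/
theorem not_upper_le_atom (L : Λ) (b : Bool) : ¬ upper L ≤ atom b := fun hL => by
  have := h.eq_of_atom_le (!b) b ((h.atom_le_upper _ L).trans hL)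
  simp at this

theorem upper_ne_bot (L : Λ) : upper L ≠ ⊥ := fun hL =>
  h.not_upper_le_atom L true (hL ▸ bot_le)

theorem exists_upper_eq_of_le {L : Λ} {x : Λ'} (hx : upper L ≤ x) : ∃ M, x = upper M := by
  rcases h.cover x with rfl | ⟨b, rfl⟩ | hM
  · exact absurd (le_bot_iff.1 hx) (h.upper_ne_bot L)
  · exact absurd hx (h.not_upper_le_atom L b)
  · exact hM

theorem eq_atom_or_exists_upper_of_le {b : Bool} {x : Λ'} (hx : atom b ≤ x) :
    x = atom b ∨ ∃ M, x = upper M := by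
  rcases h.cover x with rfl | ⟨c, rfl⟩ | hM
  · exact absurd (le_bot_iff.1 hx) (h.atom_ne_bot b)
  · exact Or.inl (by rw [h.eq_of_atom_le b c hx])
  · exact Or.inr hM

/-- The range of `upper` is an upper set with least element `upper ⊥`, so the meet of two of its
members is again a member. -/
theorem upper_inf (L M : Λ) : upper (L ⊓ M) = upper L ⊓ upper M := by
  refine le_antisymm (le_inf (upper.monotone inf_le_left) (upper.monotone inf_le_right)) ?_
  have hbot : upper ⊥ ≤ upper L ⊓ upper M :=
    le_inf (upper.monotone bot_le) (upper.monotone bot_le)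
  obtain ⟨N, hN⟩ := h.exists_upper_eq_of_le hbot
  rw [hN]
  refine upper.monotone (le_inf ?_ ?_)
  · exact upper.le_iff_le.1 (hN ▸ inf_le_left)
  · exact upper.le_iff_le.1 (hN ▸ inf_le_right)

theorem atom_inf_atom (b : Bool) : atom b ⊓ atom (!b) = ⊥ := by
  rcases h.cover (atom b ⊓ atom (!b)) with hx | ⟨c, hc⟩ | ⟨L, hL⟩
  · exact hx
  · have h₁ := h.eq_of_atom_le c b (hc ▸ inf_le_left)
    have h₂ := h.eq_of_atom_le c (!b) (hc ▸ inf_le_right)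
    simp [h₁] at h₂
  · exact absurd (hL ▸ inf_le_left) (h.not_upper_le_atom L b)

theorem not_infIrred_bot : ¬ InfIrred (⊥ : Λ') := fun hbot => by
  rcases hbot.2 (h.atom_inf_atom true) with h' | h'
  · exact h.atom_ne_bot _ h'
  · exact h.atom_ne_bot _ h'

/-- Elements strictly above an atom are in the range of `upper`, and so are their meets. -/
theorem infIrred_atom (b : Bool) : InfIrred (atom b) := by
  refine ⟨fun hmax => h.not_upper_le_atom ⊤ b (hmax (h.atom_le_upper b ⊤)), fun x y hxy => ?_⟩
  rcases h.eq_atom_or_exists_upper_of_le (hxy ▸ inf_le_left : atom b ≤ x) with hx | ⟨L, rfl⟩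
  · exact Or.inl hx
  rcases h.eq_atom_or_exists_upper_of_le (hxy ▸ inf_le_right : atom b ≤ y) with hy | ⟨M, rfl⟩
  · exact Or.inr hy
  exact absurd (h.upper_inf L M ▸ hxy).le (h.not_upper_le_atom _ b)

/-- Irreducibility involves only the elements above, and everything above `upper L` comes from `Λ`.
This includes `L = ⊥`. -/
theorem infIrred_upper_iff (L : Λ) : InfIrred (upper L) ↔ InfIrred L := by
  refine and_congr (not_congr ?_) ?_
  · refine ⟨fun hmax M hM => upper.le_iff_le.1 (hmax (upper.monotone hM)), fun hmax x hx => ?_⟩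
    obtain ⟨M, rfl⟩ := h.exists_upper_eq_of_le hx
    exact upper.monotone (hmax (upper.le_iff_le.1 hx))
  · constructor
    · intro hirr M N hMN
      refine (hirr (b := upper M) (c := upper N) ?_).imp (fun e => upper.injective e)
        (fun e => upper.injective e)
      rw [← h.upper_inf, hMN]
    · intro hirr x y hxy
      obtain ⟨M, rfl⟩ := h.exists_upper_eq_of_le (hxy ▸ inf_le_left : upper L ≤ x)
      obtain ⟨N, rfl⟩ := h.exists_upper_eq_of_le (hxy ▸ inf_le_right : upper L ≤ y)
      rw [← h.upper_inf] at hxy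
      exact (hirr (upper.injective hxy)).imp (congrArg upper) (congrArg upper)

/-! #### Complete distributivity -/

/-- Each atom is completely join-prime: an element not above it is `⊥` or the other atom, hence a
supremum of such elements stays below the other atom. -/
theorem atom_le_iSup_iff (b : Bool) {ι : Sort*} (x : ι → Λ') :
    atom b ≤ ⨆ i, x i ↔ ∃ i, atom b ≤ x i := by
  refine ⟨fun hb => ?_, fun ⟨i, hi⟩ => hi.trans (le_iSup x i)⟩
  by_contra! hx
  have hle : ⨆ i, x i ≤ atom (!b) := iSup_le fun i => by
    rcases h.cover (x i) with hi | ⟨c, hc⟩ | ⟨L, hL⟩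
    · exact hi ▸ bot_le
    · have : c = !b := by
        have hcb : b ≠ c := fun e => hx i (by rw [hc, e])
        cases b <;> cases c <;> simp_all
      rw [hc, this]
    · exact absurd (hL ▸ h.atom_le_upper b L) (hx i)
  have := h.eq_of_atom_le _ _ (hb.trans hle)
  simp at this

omit h in
/-- The retraction of the suspension of a lattice onto the lattice. -/
def retract (upper : Λ ↪o Λ') (x : Λ') : Λ := sSup {L | upper L ≤ x}

omit h in
theorem retract_upper (L : Λ) : retract upper (upper L) = L :=
  le_antisymm (sSup_le fun _ hM => upper.le_iff_le.1 hM) (le_sSup le_rfl)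

omit h in
theorem retract_of_not_le {x : Λ'} (hx : ∀ L, ¬ upper L ≤ x) : retract upper x = ⊥ :=
  bot_unique (sSup_le fun L hL => absurd hL (hx L))

/-- With `gc_lower_retract`, this gives `retract` an adjoint on each side, so it preserves all
suprema and all infima. -/
theorem gc_retract_upper : GaloisConnection (retract upper) upper := fun x L => by
  rcases h.cover x with rfl | ⟨b, rfl⟩ | ⟨M, rfl⟩
  · rw [retract_of_not_le fun M hM => h.upper_ne_bot M (le_bot_iff.1 hM)]
    simp
  · rw [retract_of_not_le fun M => h.not_upper_le_atom M b]
    simp [h.atom_le_upper]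
  · rw [retract_upper, upper.le_iff_le]

-- The left adjoint agrees with `upper` except at `⊥`: `⊥ ≤ retract upper x` holds for every `x`,
-- even when `upper ⊥ ≤ x` fails.
open Classical in
theorem gc_lower_retract :
    GaloisConnection (fun L : Λ => if L = ⊥ then (⊥ : Λ') else upper L) (retract upper) := by
  intro L x
  by_cases hL : L = ⊥
  · simp [hL]
  · simp only [hL, if_false]
    refine ⟨fun hx => le_sSup hx, fun hx => ?_⟩
    by_cases hex : ∃ M, upper M ≤ x
    · obtain ⟨M, hM⟩ := hex
      obtain ⟨N, rfl⟩ := h.exists_upper_eq_of_le hM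
      rwa [retract_upper, ← upper.le_iff_le] at hx
    · rw [retract_of_not_le (not_exists.1 hex), le_bot_iff] at hx
      exact absurd hx hL

omit h in
/-- The coordinates which embed the suspension of a lattice into a product. -/
def coord (atom : Bool → Λ') (upper : Λ ↪o Λ') (x : Λ') : (Bool → Prop) × Λ :=
  (fun b => atom b ≤ x, retract upper x)

/-- An element above both atoms lies in the range of `upper`, where `retract` recovers it; elsewhere
the atoms below an element determine it. -/
theorem le_of_coord_le {x y : Λ'} (hxy : coord atom upper x ≤ coord atom upper y) : x ≤ y := by
  obtain ⟨h₁, h₂⟩ := hxy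
  rcases h.cover x with rfl | ⟨b, rfl⟩ | ⟨L, rfl⟩
  · exact bot_le
  · exact h₁ b le_rfl
  · have hy (b : Bool) : atom b ≤ y := h₁ b (h.atom_le_upper b L)
    rcases h.eq_atom_or_exists_upper_of_le (hy true) with rfl | ⟨M, rfl⟩
    · exact absurd (h.eq_of_atom_le _ _ (hy false)) (by decide)
    · refine upper.monotone ?_
      simpa only [coord, retract_upper] using h₂

theorem coord_injective : Function.Injective (coord atom upper) := fun _ _ hxy =>
  le_antisymm (h.le_of_coord_le hxy.le) (h.le_of_coord_le hxy.ge)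

theorem coord_iInf {ι : Sort*} (x : ι → Λ') : coord atom upper (⨅ i, x i) =
    ⨅ i, coord atom upper (x i) := by
  refine Prod.ext (funext fun b => ?_) ?_
  · rw [Prod.fst_iInf, iInf_apply, iInf_Prop_eq]
    exact propext le_iInf_iff
  · rw [Prod.snd_iInf]
    exact h.gc_lower_retract.u_iInf

theorem coord_iSup {ι : Sort*} (x : ι → Λ') : coord atom upper (⨆ i, x i) =
    ⨆ i, coord atom upper (x i) := by
  refine Prod.ext (funext fun b => ?_) ?_
  · rw [Prod.fst_iSup, iSup_apply, iSup_Prop_eq]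
    exact propext (h.atom_le_iSup_iff b x)
  · rw [Prod.snd_iSup]
    exact h.gc_retract_upper.l_iSup

/-- The distributive law holds in the product of copies of Prop with `Λ` and is pulled back along
the injection `coord`, which preserves all infima and suprema. -/
theorem completelyDistrib (hΛ : CompletelyDistribLattice.MinimalAxioms Λ) :
    CompletelyDistribLattice.MinimalAxioms Λ' where
  iInf_iSup_eq f := h.coord_injective (by
    let _ : CompletelyDistribLattice Λ := .ofMinimalAxioms hΛ
    have key := iInf_iSup_eq (f := fun a b => coord atom upper (f a b))
    simp only [h.coord_iInf, h.coord_iSup]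
    exact key)

end IsLatticeSuspension

end LatticeSuspension

/-! ### Meet-irreducible elements of a lattice suspension -/

section MeetIrrSuspension

variable {H H' : Type*} [NormedAddCommGroup H] [InnerProductSpace ℂ H] [NormedAddCommGroup H']
  [InnerProductSpace ℂ H'] {A : Subalgebra ℂ (H →L[ℂ] H)} {A' : Subalgebra ℂ (H' →L[ℂ] H')}
  {atom : Bool → invLattice A'} {upper : invLattice A ↪o invLattice A'}

namespace IsLatticeSuspension

variable (h : IsLatticeSuspension atom upper)

/-- The map from the two-point suspension of `M(Lat A)` to `M(Lat A')`, for a suspension `Lat A'`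
of the lattice `Lat A`. -/
def meetIrrMap : TwoPointSuspension (MeetIrr A) → MeetIrr A'
  | .inl b => ⟨atom b, h.infIrred_atom b⟩
  | .inr L => ⟨upper L.1, (h.infIrred_upper_iff L.1).2 L.2⟩

theorem meetIrrMap_le_iff (x y : TwoPointSuspension (MeetIrr A)) :
    h.meetIrrMap x ≤ h.meetIrrMap y ↔ x ≤ y := by
  rcases x with b | L <;> rcases y with c | M
  · exact ⟨h.eq_of_atom_le b c, fun e => (congrArg atom e).le⟩
  · exact ⟨fun _ => trivial, fun _ => h.atom_le_upper b M.1⟩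
  · exact ⟨fun e => h.not_upper_le_atom L.1 c e, fun e => e.elim⟩
  · exact upper.le_iff_le

theorem meetIrrMap_surjective : Function.Surjective h.meetIrrMap := by
  rintro ⟨x, hx⟩
  rcases h.cover x with rfl | ⟨b, rfl⟩ | ⟨L, rfl⟩
  · exact absurd hx h.not_infIrred_bot
  · exact ⟨.inl b, rfl⟩
  · exact ⟨.inr ⟨L, (h.infIrred_upper_iff L).1 hx⟩, rfl⟩

/-- The isomorphism of the two-point suspension of `M(Lat A)` with `M(Lat A')`. -/
def meetIrrOrderIso : TwoPointSuspension (MeetIrr A) ≃o MeetIrr A' :=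
  RelIso.ofSurjective (OrderEmbedding.ofMapLEIff h.meetIrrMap h.meetIrrMap_le_iff)
    h.meetIrrMap_surjective

end IsLatticeSuspension

theorem MeetIrr.isClopen_setOf_le (L : invLattice A) : IsClopen {M : MeetIrr A | L ≤ M.1} :=
  ⟨⟨.basic _ ⟨L, Or.inr rfl⟩⟩, .basic _ ⟨L, Or.inl rfl⟩⟩

namespace IsLatticeSuspension

variable (h : IsLatticeSuspension atom upper)

include h

theorem isClopen_setOf_le_upper (x : invLattice A') :
    IsClopen {M : MeetIrr A | x ≤ upper M.1} := by
  rcases h.cover x with rfl | ⟨b, rfl⟩ | ⟨L, rfl⟩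
  · simpa using! isClopen_univ
  · simpa [h.atom_le_upper] using! isClopen_univ
  · simpa using! MeetIrr.isClopen_setOf_le L

theorem continuous_meetIrrMap : Continuous h.meetIrrMap := by
  have key (x : invLattice A') : IsClopen (h.meetIrrMap ⁻¹' {M | x ≤ M.1}) :=
    ⟨isClosed_sum_iff.2 ⟨isClosed_discrete _, (h.isClopen_setOf_le_upper x).1⟩,
      isOpen_sum_iff.2 ⟨isOpen_discrete _, (h.isClopen_setOf_le_upper x).2⟩⟩
  refine continuous_generateFrom_iff.2 ?_
  rintro _ ⟨x, rfl | rfl⟩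
  · exact (key x).isOpen
  · exact (key x).compl.isOpen

theorem image_inr_setOf_le (L : invLattice A) :
    (fun M => h.meetIrrMap (.inr M)) '' {M : MeetIrr A | L ≤ M.1} = {M | upper L ≤ M.1} := by
  ext x
  constructor
  · rintro ⟨M, hM, rfl⟩
    exact upper.monotone hM
  · intro hx
    obtain ⟨b | M, rfl⟩ := h.meetIrrMap_surjective x
    · exact absurd hx (h.not_upper_le_atom L b)
    · exact ⟨M, upper.le_iff_le.1 hx, rfl⟩

theorem meetIrrMap_injective : Function.Injective h.meetIrrMap :=
  h.meetIrrOrderIso.injective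

/-- The image of the whole space is the clopen set of elements above `upper ⊥`; complements of
subbasic sets are taken inside it. -/
theorem isOpenMap_inr : IsOpenMap fun M : MeetIrr A => h.meetIrrMap (.inr M) := by
  have hinj : Function.Injective fun M : MeetIrr A => h.meetIrrMap (.inr M) :=
    h.meetIrrMap_injective.comp Sum.inr_injective
  have huniv := h.image_inr_setOf_le ⊥
  simp only [bot_le, Set.ofPred_true] at huniv
  intro U hU
  induction hU with
  | basic U hU =>
    obtain ⟨L, rfl | rfl⟩ := hU
    · rw [image_inr_setOf_le]
      exact (MeetIrr.isClopen_setOf_le _).isOpen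
    · rw [Set.compl_eq_univ_sdiff, Set.image_sdiff hinj, huniv, image_inr_setOf_le]
      exact (MeetIrr.isClopen_setOf_le _).isOpen.sdiff (MeetIrr.isClopen_setOf_le _).isClosed
  | univ =>
    rw [huniv]
    exact (MeetIrr.isClopen_setOf_le _).isOpen
  | inter U V _ _ hU hV =>
    rw [Set.image_inter hinj]
    exact hU.inter hV
  | sUnion S _ hS =>
    rw [Set.image_sUnion]
    exact isOpen_sUnion (by rintro _ ⟨U, hU, rfl⟩; exact hS U hU)

/-- Above `atom b` but not above `upper ⊥` there is only `atom b` itself. -/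
theorem isOpen_singleton_inl (b : Bool) : IsOpen {h.meetIrrMap (.inl b)} := by
  have : {h.meetIrrMap (.inl b)} = {M : MeetIrr A' | atom b ≤ M.1} \ {M | upper ⊥ ≤ M.1} := by
    ext x
    constructor
    · rintro rfl
      exact ⟨le_refl (atom b), h.not_upper_le_atom ⊥ b⟩
    · rintro ⟨hx, hx'⟩
      rcases h.eq_atom_or_exists_upper_of_le hx with hb | ⟨M, hM⟩
      · exact Subtype.ext hb
      · exact absurd ((upper.monotone bot_le).trans_eq hM.symm) hx'
  rw [this]
  exact (MeetIrr.isClopen_setOf_le _).isOpen.sdiff (MeetIrr.isClopen_setOf_le _).isClosed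

theorem isHomeomorph_meetIrrOrderIso : IsHomeomorph h.meetIrrOrderIso where
  continuous := h.continuous_meetIrrMap
  isOpenMap := isOpenMap_sum.2 ⟨fun U _ => by
    rw [← Set.biUnion_of_singleton U, Set.image_iUnion₂]
    refine isOpen_biUnion fun b _ => ?_
    rw [Set.image_singleton]
    exact h.isOpen_singleton_inl b, h.isOpenMap_inr⟩
  bijective := h.meetIrrOrderIso.bijective

end IsLatticeSuspension

end MeetIrrSuspension

/-! ### Type I factors with commuting invariant projections -/

section TypeIFactor

variable {K : Type*} [NormedAddCommGroup K] [InnerProductSpace ℂ K]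

/-- The smallest invariant closed subspace which contains a given vector. -/
def cyclicSubspace (A : Subalgebra ℂ (K →L[ℂ] K)) (ξ : K) : ClosedSubmodule ℂ K :=
  sInf {M | M ∈ invLattice A ∧ ξ ∈ M}

theorem cyclicSubspace_mem (A : Subalgebra ℂ (K →L[ℂ] K)) (ξ : K) :
    cyclicSubspace A ξ ∈ invLattice A :=
  CompleteSublattice.sInfClosed fun _ hM => hM.1

theorem self_mem_cyclicSubspace (A : Subalgebra ℂ (K →L[ℂ] K)) (ξ : K) :
    ξ ∈ cyclicSubspace A ξ :=
  ClosedSubmodule.mem_sInf.2 fun _ hM => hM.2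

theorem cyclicSubspace_le {A : Subalgebra ℂ (K →L[ℂ] K)} {ξ : K} {M : ClosedSubmodule ℂ K}
    (hM : M ∈ invLattice A) (hξ : ξ ∈ M) : cyclicSubspace A ξ ≤ M :=
  sInf_le ⟨hM, hξ⟩

variable [CompleteSpace K] {B : VonNeumannAlgebra K}

theorem VonNeumannAlgebra.starProjection_mem_iff {M : ClosedSubmodule ℂ K} :
    M.toSubmodule.starProjection ∈ B ↔ M ∈ invLattice B.commutant.toAlgebra := by
  rw [VonNeumannAlgebra.IsStarProjection.mem_iff isStarProjection_starProjection]
  simp only [Submodule.range_starProjection]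
  rfl

theorem VonNeumannAlgebra.starProjection_mem_commutant {M : ClosedSubmodule ℂ K}
    (hM : M ∈ invLattice B.toAlgebra) : M.toSubmodule.starProjection ∈ B.commutant := by
  rwa [starProjection_mem_iff, commutant_commutant]

/-- The preimage of an invariant subspace under an operator in the commutant is invariant. -/
theorem VonNeumannAlgebra.comap_mem_invLattice {M : ClosedSubmodule ℂ K} {T : K →L[ℂ] K}
    (hM : M ∈ invLattice B.toAlgebra) (hT : T ∈ B.commutant) :
    M.comap T ∈ invLattice B.toAlgebra := fun S hS x hx => by
  have hc : S (T x) = T (S x) := DFunLike.congr_fun (mem_commutant_iff.1 hT S hS) x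
  change T (S x) ∈ M
  rw [← hc]
  exact hM S hS _ hx

/-- The line through a vector. -/
def closedLine (ξ : K) : ClosedSubmodule ℂ K :=
  ⟨Submodule.span ℂ {ξ}, Submodule.closed_of_finiteDimensional _⟩

omit [CompleteSpace K] in
theorem mem_closedLine {ξ x : K} : x ∈ closedLine ξ ↔ ∃ c : ℂ, c • ξ = x :=
  Submodule.mem_span_singleton

variable {p : K →L[ℂ] K} (hpB : p ∈ B) (hmin : ∀ T ∈ B, ∃ c : ℂ, p * T * p = c • p)

include hpB hmin

-- For `T ∈ B`, minimality gives `p T ξ = p T p ξ ∈ ℂ ξ`. The vectors `y` with `p T y ∈ ℂ ξ` for all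
-- `T ∈ B` form a closed invariant subspace containing `ξ`, hence the cyclic subspace; take `T = 1`.
omit hpB in
theorem exists_smul_eq_of_mem_cyclicSubspace {ξ x : K} (hξ : p ξ = ξ)
    (hx : x ∈ cyclicSubspace B.toAlgebra ξ) : ∃ c : ℂ, c • ξ = p x := by
  let N : ClosedSubmodule ℂ K := ⨅ T : {T // T ∈ B}, (closedLine ξ).comap (p * T.1)
  have hN : N ∈ invLattice B.toAlgebra := fun S hS y hy => by
    rw [ClosedSubmodule.mem_iInf] at hy ⊢
    intro T
    have := hy ⟨T.1 * S, mul_mem T.2 hS⟩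
    rwa [ClosedSubmodule.mem_comap] at this ⊢
  have hξN : ξ ∈ N := by
    rw [ClosedSubmodule.mem_iInf]
    intro T
    obtain ⟨c, hc⟩ := hmin T T.2
    refine mem_closedLine.2 ⟨c, ?_⟩
    have := DFunLike.congr_fun hc ξ
    simpa [hξ] using this.symm
  have := ClosedSubmodule.mem_iInf.1 (cyclicSubspace_le hN hξN hx) ⟨1, one_mem B⟩
  exact mem_closedLine.1 this

/-- The projection onto an invariant subspace lies in the commutant, so it commutes with `p` and
keeps `η` in the range of `p`. -/
theorem starProjection_cyclicSubspace_eq_smul {ξ η : K} (hξ : p ξ = ξ) (hη : p η = η) :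
    ∃ c : ℂ, c • ξ = (cyclicSubspace B.toAlgebra ξ).toSubmodule.starProjection η := by
  obtain ⟨c, hc⟩ := exists_smul_eq_of_mem_cyclicSubspace hmin hξ
    (Submodule.starProjection_apply_mem (cyclicSubspace B.toAlgebra ξ).toSubmodule η)
  refine ⟨c, hc.trans ?_⟩
  have := VonNeumannAlgebra.mem_commutant_iff.1
    (VonNeumannAlgebra.starProjection_mem_commutant (cyclicSubspace_mem B.toAlgebra ξ)) p hpB
  simpa [hη] using DFunLike.congr_fun this η

/-- Let P, Q be the projections onto the cyclic subspaces of `ξ`, `η`, with Q ξ = a η and P η = b ξ.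
Then PQ ξ = QP ξ reads a b ξ = a η: either `η = b ξ`, or a = 0 and `ξ` is orthogonal to `η`. -/
theorem inner_eq_zero_or_exists_smul_eq (hcomm : InvProjectionsCommute B.toAlgebra) {ξ η : K}
    (hξ : p ξ = ξ) (hη : p η = η) : inner ℂ η ξ = 0 ∨ ∃ c : ℂ, c • ξ = η := by
  obtain ⟨a, ha⟩ := starProjection_cyclicSubspace_eq_smul hpB hmin hη hξ
  obtain ⟨b, hb⟩ := starProjection_cyclicSubspace_eq_smul hpB hmin hξ hη
  have hc := DFunLike.congr_fun (hcomm _ (cyclicSubspace_mem B.toAlgebra ξ) _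
    (cyclicSubspace_mem B.toAlgebra η)).eq ξ
  simp only [mul_apply_eq_comp] at hc
  rw [Submodule.starProjection_eq_self_iff.2 (self_mem_cyclicSubspace B.toAlgebra ξ), ← ha,
    map_smul, ← hb] at hc
  by_cases h0 : a = 0
  · left
    rw [h0, zero_smul, eq_comm, Submodule.starProjection_apply_eq_zero_iff] at ha
    exact ha η (self_mem_cyclicSubspace B.toAlgebra η)
  · exact Or.inr ⟨b, smul_right_injective K h0 hc⟩

theorem exists_smul_eq_of_minimal (hcomm : InvProjectionsCommute B.toAlgebra) {ξ η : K}
    (hξ : p ξ = ξ) (hξ₀ : ξ ≠ 0) (hη : p η = η) : ∃ c : ℂ, c • ξ = η := by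
  refine (inner_eq_zero_or_exists_smul_eq hpB hmin hcomm hξ hη).elim (fun h₁ => ?_) id
  -- If `η` is orthogonal to `ξ`, then `ξ + η` is not, so it must be a multiple of `ξ`.
  refine (inner_eq_zero_or_exists_smul_eq hpB hmin hcomm hξ
    (η := ξ + η) (by rw [map_add, hξ, hη])).elim (fun h₂ => ?_) ?_
  · rw [inner_add_left, h₁, add_zero] at h₂
    exact absurd (inner_self_eq_zero.1 h₂) hξ₀
  · rintro ⟨c, hc⟩
    exact ⟨c - 1, by rw [sub_smul, hc, one_smul, add_sub_cancel_left]⟩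

theorem exists_smul_eq_of_mem_commutant (hcomm : InvProjectionsCommute B.toAlgebra) {ξ : K}
    (hξ : p ξ = ξ) (hξ₀ : ξ ≠ 0) {T : K →L[ℂ] K} (hT : T ∈ B.commutant) :
    ∃ c : ℂ, c • ξ = T ξ := by
  refine exists_smul_eq_of_minimal hpB hmin hcomm hξ hξ₀ ?_
  have := DFunLike.congr_fun (VonNeumannAlgebra.mem_commutant_iff.1 hT p hpB) ξ
  simpa [hξ] using this

/-- Operators of the commutant scale `ξ`, so the cyclic subspace is invariant under the commutant as
well. Its projection is then central, hence a scalar, and it fixes `ξ ≠ 0`. -/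
theorem cyclicSubspace_eq_top (hcomm : InvProjectionsCommute B.toAlgebra)
    (hfactor : ∀ T ∈ B, T ∈ B.commutant → ∃ c : ℂ, T = c • 1) {ξ : K}
    (hξ : p ξ = ξ) (hξ₀ : ξ ≠ 0) : cyclicSubspace B.toAlgebra ξ = ⊤ := by
  set M := cyclicSubspace B.toAlgebra ξ with hM
  have hMB : M ∈ invLattice B.toAlgebra := cyclicSubspace_mem _ _
  have hξM : ξ ∈ M := self_mem_cyclicSubspace _ _
  have hMB' : M ∈ invLattice B.commutant.toAlgebra := fun T hT x hx => by
    have hTξ : ξ ∈ M.comap T := by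
      obtain ⟨c, hc⟩ := exists_smul_eq_of_mem_commutant hpB hmin hcomm hξ hξ₀ hT
      change T ξ ∈ M
      rw [← hc]
      exact SMulMemClass.smul_mem c hξM
    exact cyclicSubspace_le (VonNeumannAlgebra.comap_mem_invLattice hMB hT) hTξ hx
  obtain ⟨c, hc⟩ := hfactor _ (VonNeumannAlgebra.starProjection_mem_iff.2 hMB')
    (VonNeumannAlgebra.starProjection_mem_commutant hMB)
  have h₁ : c • ξ = ξ := by
    have := DFunLike.congr_fun hc ξ
    rw [Submodule.starProjection_eq_self_iff.2 hξM] at this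
    simpa using this.symm
  have hc₁ : c = 1 := by
    rw [← sub_eq_zero]
    refine (smul_eq_zero.1 (?_ : (c - 1) • ξ = 0)).resolve_right hξ₀
    rw [sub_smul, h₁, one_smul, sub_self]
  refine top_unique fun x _ => Submodule.starProjection_eq_self_iff.1 ?_
  rw [hc, hc₁]
  simp

omit hpB hmin in
theorem IsTypeIFactor.exists_cyclic (hB : IsTypeIFactor B)
    (hcomm : InvProjectionsCommute B.toAlgebra) : ∃ ξ : K,
      (∀ M ∈ invLattice B.toAlgebra, ξ ∈ M → M = ⊤) ∧
      ∀ T ∈ B.commutant, ∃ c : ℂ, c • ξ = T ξ := by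
  obtain ⟨p, hpB, hp, hp₀, hmin⟩ := hB.typeI
  obtain ⟨x, hx⟩ : ∃ x, p x ≠ 0 := by
    by_contra! h
    exact hp₀ (ContinuousLinearMap.ext h)
  have hξ : p (p x) = p x := DFunLike.congr_fun hp.isIdempotentElem.eq x
  refine ⟨p x, fun M hM hxM => top_unique ?_, fun T hT =>
    exists_smul_eq_of_mem_commutant hpB hmin hcomm hξ hx hT⟩
  rw [← cyclicSubspace_eq_top hpB hmin hcomm hB.factor hξ hx]
  exact cyclicSubspace_le hM hxM

omit hpB hmin in
theorem IsTypeIFactor.nontrivial (hB : IsTypeIFactor B) : Nontrivial K := by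
  obtain ⟨p, -, -, hp₀, -⟩ := hB.typeI
  by_contra h
  rw [not_nontrivial_iff_subsingleton] at h
  exact hp₀ (Subsingleton.elim _ _)

omit hpB hmin in
/-- A type I factor with commuting invariant projections is the algebra of all operators. -/
theorem IsTypeIFactor.mem_of_commute (hB : IsTypeIFactor B)
    (hcomm : InvProjectionsCommute B.toAlgebra) (T : K →L[ℂ] K) : T ∈ B := by
  obtain ⟨ξ, htop, hsmul⟩ := hB.exists_cyclic hcomm
  -- By the double commutant it suffices that the commutant is scalar: the kernel of `S - c` is
  -- `B`-invariant and contains the cyclic vector `ξ`.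
  rw [← B.commutant_commutant, VonNeumannAlgebra.mem_commutant_iff]
  intro S hS
  obtain ⟨c, hc⟩ := hsmul S hS
  have hN : (⊥ : ClosedSubmodule ℂ K).comap (S - c • 1) ∈ invLattice B.toAlgebra :=
    VonNeumannAlgebra.comap_mem_invLattice CompleteSublattice.bot_mem
      (sub_mem hS (B.commutant.toAlgebra.smul_mem (one_mem _) c))
  have htop := htop _ hN (by simp [← hc])
  have hSc : S = c • 1 := by
    ext x
    have hx : x ∈ (⊥ : ClosedSubmodule ℂ K).comap (S - c • 1) := htop ▸ ClosedSubmodule.mem_top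
    simpa [sub_eq_zero] using hx
  rw [hSc]
  simp

end TypeIFactor

/-- The only closed subspaces invariant under all bounded operators are the trivial ones. -/
theorem eq_bot_or_eq_top_of_forall_mem {K : Type*} [NormedAddCommGroup K] [InnerProductSpace ℂ K]
    {M : ClosedSubmodule ℂ K} (hM : ∀ T : K →L[ℂ] K, ∀ x ∈ M, T x ∈ M) : M = ⊥ ∨ M = ⊤ := by
  by_cases h : ∃ x ∈ M, x ≠ 0
  · obtain ⟨x, hx, hx₀⟩ := h
    refine Or.inr (top_unique fun y _ => ?_)
    -- A rank-one operator taking `x` to `y`.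
    have := hM ((innerSL ℂ x).smulRight (((inner ℂ x x)⁻¹ : ℂ) • y)) x hx
    rwa [ContinuousLinearMap.smulRight_apply, innerSL_apply_apply, smul_smul,
      mul_inv_cancel₀ (inner_self_eq_zero.not.2 hx₀), one_smul] at this
  · push Not at h
    exact Or.inl (bot_unique fun x hx => ClosedSubmodule.mem_bot.2 (h x hx))

/-! ### The invariant subspaces of the suspension -/

theorem ClosedSubmodule.bot_ne_top {K : Type*} [NormedAddCommGroup K] [InnerProductSpace ℂ K]
    [Nontrivial K] : (⊥ : ClosedSubmodule ℂ K) ≠ ⊤ := fun h => by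
  obtain ⟨x, hx⟩ := exists_ne (0 : K)
  exact hx (ClosedSubmodule.mem_bot.1 (h ▸ ClosedSubmodule.mem_top))

section SuspensionLattice

variable {K₁ K₂ H : Type*}
  [NormedAddCommGroup K₁] [InnerProductSpace ℂ K₁]
  [NormedAddCommGroup K₂] [InnerProductSpace ℂ K₂]
  [NormedAddCommGroup H] [InnerProductSpace ℂ H]

variable (K₁ K₂ H) in
/-- The projection to the first summand. -/
def proj₁ : HilbertSum₃ K₁ K₂ H →L[ℂ] K₁ := WithLp.fstL 2 ℂ _ _

variable (K₁ K₂ H) in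
/-- The projection to the second summand. -/
def proj₂ : HilbertSum₃ K₁ K₂ H →L[ℂ] K₂ := WithLp.fstL 2 ℂ _ _ ∘L WithLp.sndL 2 ℂ _ _

variable (K₁ K₂ H) in
/-- The projection to the third summand. -/
def proj₃ : HilbertSum₃ K₁ K₂ H →L[ℂ] H := WithLp.sndL 2 ℂ _ _ ∘L WithLp.sndL 2 ℂ _ _

/-- The operator into the Hilbert sum with given components. -/
def col {E : Type*} [NormedAddCommGroup E] [InnerProductSpace ℂ E] (f : E →L[ℂ] K₁)
    (g : E →L[ℂ] K₂) (k : E →L[ℂ] H) : E →L[ℂ] HilbertSum₃ K₁ K₂ H :=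
  ((WithLp.prodContinuousLinearEquiv 2 ℂ K₁ (WithLp 2 (K₂ × H))).symm :
      K₁ × WithLp 2 (K₂ × H) →L[ℂ] HilbertSum₃ K₁ K₂ H) ∘L
    f.prod (((WithLp.prodContinuousLinearEquiv 2 ℂ K₂ H).symm :
      K₂ × H →L[ℂ] WithLp 2 (K₂ × H)) ∘L g.prod k)

@[simp] theorem col_apply {E : Type*} [NormedAddCommGroup E] [InnerProductSpace ℂ E]
    (f : E →L[ℂ] K₁) (g : E →L[ℂ] K₂) (k : E →L[ℂ] H) (v : E) :
    col f g k v = vec₃ (f v) (g v) (k v) := rfl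

@[simp] theorem proj₁_vec₃ (k₁ : K₁) (k₂ : K₂) (h : H) : proj₁ K₁ K₂ H (vec₃ k₁ k₂ h) = k₁ := rfl

@[simp] theorem proj₂_vec₃ (k₁ : K₁) (k₂ : K₂) (h : H) : proj₂ K₁ K₂ H (vec₃ k₁ k₂ h) = k₂ := rfl

@[simp] theorem proj₃_vec₃ (k₁ : K₁) (k₂ : K₂) (h : H) : proj₃ K₁ K₂ H (vec₃ k₁ k₂ h) = h := rfl

omit [NormedAddCommGroup K₁] [InnerProductSpace ℂ K₁] [NormedAddCommGroup K₂]
  [InnerProductSpace ℂ K₂] [NormedAddCommGroup H] [InnerProductSpace ℂ H] in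
theorem exists_eq_vec₃ (v : HilbertSum₃ K₁ K₂ H) : ∃ k₁ k₂ h, v = vec₃ k₁ k₂ h :=
  ⟨_, _, _, rfl⟩

omit [InnerProductSpace ℂ K₁] [InnerProductSpace ℂ K₂] [InnerProductSpace ℂ H] in
theorem vec₃_add (k₁ l₁ : K₁) (k₂ l₂ : K₂) (h m : H) :
    vec₃ (k₁ + l₁) (k₂ + l₂) (h + m) = vec₃ k₁ k₂ h + vec₃ l₁ l₂ m := rfl

omit [InnerProductSpace ℂ K₁] [InnerProductSpace ℂ K₂] [InnerProductSpace ℂ H] in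
theorem vec₃_sub (k₁ l₁ : K₁) (k₂ l₂ : K₂) (h m : H) :
    vec₃ (k₁ - l₁) (k₂ - l₂) (h - m) = vec₃ k₁ k₂ h - vec₃ l₁ l₂ m := rfl

omit [InnerProductSpace ℂ K₁] [InnerProductSpace ℂ K₂] [InnerProductSpace ℂ H] in
theorem vec₃_zero : vec₃ (0 : K₁) (0 : K₂) (0 : H) = 0 := rfl

omit [InnerProductSpace ℂ K₁] [InnerProductSpace ℂ K₂] [InnerProductSpace ℂ H] in
theorem vec₃_eq_add (k₁ : K₁) (k₂ : K₂) (h : H) :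
    vec₃ k₁ k₂ h = vec₃ k₁ 0 0 + vec₃ 0 k₂ 0 + vec₃ 0 0 h := by
  simp [← vec₃_add]

theorem inner_vec₃ (k₁ l₁ : K₁) (k₂ l₂ : K₂) (h m : H) :
    inner ℂ (vec₃ k₁ k₂ h) (vec₃ l₁ l₂ m) = inner ℂ k₁ l₁ + inner ℂ k₂ l₂ + inner ℂ h m := by
  simp only [vec₃, WithLp.prod_inner_apply, add_assoc]

/-- The closed subspace `M₁ ⊕ M₂ ⊕ M₃` of `K₁ ⊕ K₂ ⊕ H`. -/
def sum₃ (M₁ : ClosedSubmodule ℂ K₁) (M₂ : ClosedSubmodule ℂ K₂) (M₃ : ClosedSubmodule ℂ H) :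
    ClosedSubmodule ℂ (HilbertSum₃ K₁ K₂ H) :=
  M₁.comap (proj₁ K₁ K₂ H) ⊓ (M₂.comap (proj₂ K₁ K₂ H) ⊓ M₃.comap (proj₃ K₁ K₂ H))

@[simp] theorem vec₃_mem_sum₃ {M₁ : ClosedSubmodule ℂ K₁} {M₂ : ClosedSubmodule ℂ K₂}
    {M₃ : ClosedSubmodule ℂ H} {k₁ : K₁} {k₂ : K₂} {h : H} :
    vec₃ k₁ k₂ h ∈ sum₃ M₁ M₂ M₃ ↔ k₁ ∈ M₁ ∧ k₂ ∈ M₂ ∧ h ∈ M₃ := Iff.rfl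

theorem sum₃_le_sum₃_iff {M₁ N₁ : ClosedSubmodule ℂ K₁} {M₂ N₂ : ClosedSubmodule ℂ K₂}
    {M₃ N₃ : ClosedSubmodule ℂ H} :
    sum₃ M₁ M₂ M₃ ≤ sum₃ N₁ N₂ N₃ ↔ M₁ ≤ N₁ ∧ M₂ ≤ N₂ ∧ M₃ ≤ N₃ := by
  constructor
  · refine fun hle => ⟨fun k hk => ?_, fun k hk => ?_, fun k hk => ?_⟩
    · exact (vec₃_mem_sum₃.1 (hle (vec₃_mem_sum₃.2 ⟨hk, zero_mem _, zero_mem _⟩))).1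
    · exact (vec₃_mem_sum₃.1 (hle (vec₃_mem_sum₃.2 ⟨zero_mem _, hk, zero_mem _⟩))).2.1
    · exact (vec₃_mem_sum₃.1 (hle (vec₃_mem_sum₃.2 ⟨zero_mem _, zero_mem _, hk⟩))).2.2
  · rintro ⟨h₁, h₂, h₃⟩ v ⟨hv₁, hv₂, hv₃⟩
    exact ⟨h₁ hv₁, h₂ hv₂, h₃ hv₃⟩

theorem sum₃_bot : sum₃ (⊥ : ClosedSubmodule ℂ K₁) (⊥ : ClosedSubmodule ℂ K₂)
    (⊥ : ClosedSubmodule ℂ H) = ⊥ := by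
  refine bot_unique fun v hv => ?_
  obtain ⟨k₁, k₂, h, rfl⟩ := exists_eq_vec₃ v
  rw [vec₃_mem_sum₃, ClosedSubmodule.mem_bot, ClosedSubmodule.mem_bot,
    ClosedSubmodule.mem_bot] at hv
  rw [ClosedSubmodule.mem_bot, hv.1, hv.2.1, hv.2.2, vec₃_zero]

variable [CompleteSpace K₁] [CompleteSpace K₂]

theorem starProjection_sum₃ [CompleteSpace H] (M₁ : ClosedSubmodule ℂ K₁)
    (M₂ : ClosedSubmodule ℂ K₂) (M₃ : ClosedSubmodule ℂ H) (k₁ : K₁) (k₂ : K₂) (h : H) :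
    (sum₃ M₁ M₂ M₃).toSubmodule.starProjection (vec₃ k₁ k₂ h) =
      vec₃ (M₁.toSubmodule.starProjection k₁) (M₂.toSubmodule.starProjection k₂)
        (M₃.toSubmodule.starProjection h) := by
  refine Submodule.eq_starProjection_of_mem_of_inner_eq_zero ?_ fun w hw => ?_
  · exact vec₃_mem_sum₃.2 ⟨Submodule.starProjection_apply_mem _ _,
      Submodule.starProjection_apply_mem _ _, Submodule.starProjection_apply_mem _ _⟩
  · obtain ⟨l₁, l₂, m, rfl⟩ := exists_eq_vec₃ w
    obtain ⟨h₁, h₂, h₃⟩ := vec₃_mem_sum₃.1 hw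
    rw [← vec₃_sub, inner_vec₃, Submodule.starProjection_inner_eq_zero _ _ h₁,
      Submodule.starProjection_inner_eq_zero _ _ h₂,
      Submodule.starProjection_inner_eq_zero _ _ h₃, add_zero, add_zero]

theorem commute_starProjection_sum₃ [CompleteSpace H] {M₁ N₁ : ClosedSubmodule ℂ K₁}
    {M₂ N₂ : ClosedSubmodule ℂ K₂} {M₃ N₃ : ClosedSubmodule ℂ H}
    (h₁ : Commute M₁.toSubmodule.starProjection N₁.toSubmodule.starProjection)
    (h₂ : Commute M₂.toSubmodule.starProjection N₂.toSubmodule.starProjection)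
    (h₃ : Commute M₃.toSubmodule.starProjection N₃.toSubmodule.starProjection) :
    Commute (sum₃ M₁ M₂ M₃).toSubmodule.starProjection
      (sum₃ N₁ N₂ N₃).toSubmodule.starProjection := by
  refine ContinuousLinearMap.ext fun v => ?_
  obtain ⟨k₁, k₂, h, rfl⟩ := exists_eq_vec₃ v
  simp only [mul_apply_eq_comp, starProjection_sum₃]
  exact congr (congr (congrArg vec₃ (DFunLike.congr_fun h₁.eq k₁)) (DFunLike.congr_fun h₂.eq k₂))
    (DFunLike.congr_fun h₃.eq h)

variable {B₁ : VonNeumannAlgebra K₁} {B₂ : VonNeumannAlgebra K₂} {A : Subalgebra ℂ (H →L[ℂ] H)}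

/-- The operator with block matrix `[[b₁, 0, x], [0, b₂, y], [0, 0, a]]`. -/
def blockOperator (b₁ : K₁ →L[ℂ] K₁) (b₂ : K₂ →L[ℂ] K₂) (a : H →L[ℂ] H) (x : H →L[ℂ] K₁)
    (y : H →L[ℂ] K₂) : HilbertSum₃ K₁ K₂ H →L[ℂ] HilbertSum₃ K₁ K₂ H :=
  col (b₁ ∘L proj₁ K₁ K₂ H + x ∘L proj₃ K₁ K₂ H) (b₂ ∘L proj₂ K₁ K₂ H + y ∘L proj₃ K₁ K₂ H)
    (a ∘L proj₃ K₁ K₂ H)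

theorem blockOperator_mem {b₁ : K₁ →L[ℂ] K₁} (hb₁ : b₁ ∈ B₁) {b₂ : K₂ →L[ℂ] K₂} (hb₂ : b₂ ∈ B₂)
    {a : H →L[ℂ] H} (ha : a ∈ A) (x : H →L[ℂ] K₁) (y : H →L[ℂ] K₂) :
    blockOperator b₁ b₂ a x y ∈ suspensionAlgebra B₁ B₂ A :=
  ⟨b₁, hb₁, b₂, hb₂, a, ha, x, y, fun _ _ _ => rfl⟩

/-- The last hypothesis handles the arbitrary entries `x`, `y`: they either act on 0 or land in a
full summand. -/
theorem sum₃_mem_invLattice {M₁ : ClosedSubmodule ℂ K₁} {M₂ : ClosedSubmodule ℂ K₂}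
    {M₃ : ClosedSubmodule ℂ H} (h₁ : M₁ ∈ invLattice B₁.toAlgebra)
    (h₂ : M₂ ∈ invLattice B₂.toAlgebra) (h₃ : M₃ ∈ invLattice A)
    (h : M₃ = ⊥ ∨ M₁ = ⊤ ∧ M₂ = ⊤) : sum₃ M₁ M₂ M₃ ∈ invLattice (suspensionAlgebra B₁ B₂ A) := by
  rintro T ⟨b₁, hb₁, b₂, hb₂, a, ha, x, y, hT⟩ v hv
  obtain ⟨k₁, k₂, m, rfl⟩ := exists_eq_vec₃ v
  obtain ⟨hk₁, hk₂, hm⟩ := vec₃_mem_sum₃.1 hv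
  rw [hT, vec₃_mem_sum₃]
  refine ⟨add_mem (h₁ b₁ hb₁ k₁ hk₁) ?_, add_mem (h₂ b₂ hb₂ k₂ hk₂) ?_, h₃ a ha m hm⟩
  · rcases h with rfl | ⟨rfl, -⟩
    · rw [ClosedSubmodule.mem_bot.1 hm, map_zero]
      exact zero_mem _
    · exact ClosedSubmodule.mem_top
  · rcases h with rfl | ⟨-, rfl⟩
    · rw [ClosedSubmodule.mem_bot.1 hm, map_zero]
      exact zero_mem _
    · exact ClosedSubmodule.mem_top

theorem exists_eq_sum₃_of_mem_invLattice (hB₁ : ∀ T, T ∈ B₁) (hB₂ : ∀ T, T ∈ B₂)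
    {M : ClosedSubmodule ℂ (HilbertSum₃ K₁ K₂ H)}
    (hM : M ∈ invLattice (suspensionAlgebra B₁ B₂ A)) :
    ∃ M₁ M₂, ∃ M₃ ∈ invLattice A, M = sum₃ M₁ M₂ M₃ ∧ (M₁ = ⊥ ∨ M₁ = ⊤) ∧ (M₂ = ⊥ ∨ M₂ = ⊤) ∧
      (M₃ = ⊥ ∨ M₁ = ⊤ ∧ M₂ = ⊤) := by
  have hblock (b₁ : K₁ →L[ℂ] K₁) (b₂ : K₂ →L[ℂ] K₂) (a) (ha : a ∈ A) (x : H →L[ℂ] K₁)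
      (y : H →L[ℂ] K₂) (k₁ : K₁) (k₂ : K₂) (h : H) (hv : vec₃ k₁ k₂ h ∈ M) :
      vec₃ (b₁ k₁ + x h) (b₂ k₂ + y h) (a h) ∈ M :=
    hM _ (blockOperator_mem (hB₁ b₁) (hB₂ b₂) ha x y) _ hv
  let M₁ := M.comap (col (ContinuousLinearMap.id ℂ K₁) 0 0)
  let M₂ := M.comap (col 0 (ContinuousLinearMap.id ℂ K₂) 0)
  let M₃ := M.comap (col 0 0 (ContinuousLinearMap.id ℂ H))
  have h₁ {k} : k ∈ M₁ ↔ vec₃ k 0 0 ∈ M := Iff.rfl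
  have h₂ {k} : k ∈ M₂ ↔ vec₃ 0 k 0 ∈ M := Iff.rfl
  have h₃ {k} : k ∈ M₃ ↔ vec₃ 0 0 k ∈ M := Iff.rfl
  have hM₁ : M₁ = ⊥ ∨ M₁ = ⊤ := eq_bot_or_eq_top_of_forall_mem fun T k hk => h₁.2 <| by
    simpa using hblock T 0 0 (zero_mem A) 0 0 _ _ _ (h₁.1 hk)
  have hM₂ : M₂ = ⊥ ∨ M₂ = ⊤ := eq_bot_or_eq_top_of_forall_mem fun T k hk => h₂.2 <| by
    simpa using hblock 0 T 0 (zero_mem A) 0 0 _ _ _ (h₂.1 hk)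
  refine ⟨M₁, M₂, M₃, fun a ha h hh => h₃.2 ?_, le_antisymm ?_ ?_, hM₁, hM₂, ?_⟩
  · simpa using hblock 0 0 a ha 0 0 _ _ _ (h₃.1 hh)
  · intro v hv
    obtain ⟨k₁, k₂, h, rfl⟩ := exists_eq_vec₃ v
    refine vec₃_mem_sum₃.2 ⟨h₁.2 ?_, h₂.2 ?_, h₃.2 ?_⟩
    -- The diagonal projections belong to the algebra, so `M` contains the components of its
    -- vectors.
    · simpa using hblock 1 0 0 (zero_mem A) 0 0 _ _ _ hv
    · simpa using hblock 0 1 0 (zero_mem A) 0 0 _ _ _ hv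
    · simpa using hblock 0 0 1 (one_mem A) 0 0 _ _ _ hv
  · intro v hv
    obtain ⟨k₁, k₂, h, rfl⟩ := exists_eq_vec₃ v
    obtain ⟨hk₁, hk₂, hh⟩ := vec₃_mem_sum₃.1 hv
    rw [vec₃_eq_add]
    exact add_mem (add_mem hk₁ hk₂) hh
  · by_cases hh : ∃ h ∈ M₃, h ≠ 0
    · obtain ⟨h, hh, h₀⟩ := hh
      -- A nonzero `h ∈ M₃` is carried to any vector of K₁ or K₂ by a rank-one corner entry.
      have hne : inner ℂ h h ≠ 0 := inner_self_eq_zero.not.2 h₀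
      refine Or.inr ⟨top_unique fun k _ => h₁.2 ?_, top_unique fun k _ => h₂.2 ?_⟩
      · simpa only [ContinuousLinearMap.smulRight_apply, innerSL_apply_apply, smul_smul,
          mul_inv_cancel₀ hne, one_smul, map_zero, zero_apply, zero_add] using
          hblock 0 0 0 (zero_mem A) ((innerSL ℂ h).smulRight ((inner ℂ h h)⁻¹ • k)) 0 _ _ _
            (h₃.1 hh)
      · simpa only [ContinuousLinearMap.smulRight_apply, innerSL_apply_apply, smul_smul,
          mul_inv_cancel₀ hne, one_smul, map_zero, zero_apply, zero_add] using
          hblock 0 0 0 (zero_mem A) 0 ((innerSL ℂ h).smulRight ((inner ℂ h h)⁻¹ • k)) _ _ _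
            (h₃.1 hh)
    · push Not at hh
      exact Or.inl (bot_unique fun h hm => ClosedSubmodule.mem_bot.2 (hh h hm))

variable (B₁ B₂ A) in
/-- The invariant subspaces `K₁` and `K₂` of the suspension. -/
def suspensionAtom (b : Bool) : invLattice (suspensionAlgebra B₁ B₂ A) :=
  ⟨sum₃ (bif b then ⊤ else ⊥) (bif b then ⊥ else ⊤) ⊥, sum₃_mem_invLattice
    (by cases b; exacts [CompleteSublattice.bot_mem, CompleteSublattice.top_mem])
    (by cases b; exacts [CompleteSublattice.top_mem, CompleteSublattice.bot_mem])
    CompleteSublattice.bot_mem (Or.inl rfl)⟩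

variable (B₁ B₂ A) in
/-- The invariant subspaces `K₁ ⊕ K₂ ⊕ L` of the suspension. -/
def suspensionUpper : invLattice A ↪o invLattice (suspensionAlgebra B₁ B₂ A) :=
  OrderEmbedding.ofMapLEIff
    (fun L => ⟨sum₃ ⊤ ⊤ L.1, sum₃_mem_invLattice CompleteSublattice.top_mem
      CompleteSublattice.top_mem L.2 (Or.inr ⟨rfl, rfl⟩)⟩)
    fun L M => by
      refine (sum₃_le_sum₃_iff (M₃ := L.1) (N₃ := M.1)).trans ?_
      simp

theorem isLatticeSuspension_suspensionAlgebra [Nontrivial K₁] [Nontrivial K₂]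
    (hB₁ : ∀ T, T ∈ B₁) (hB₂ : ∀ T, T ∈ B₂) :
    IsLatticeSuspension (suspensionAtom B₁ B₂ A) (suspensionUpper B₁ B₂ A) where
  atom_le_upper b L := sum₃_le_sum₃_iff.2 ⟨le_top, le_top, bot_le⟩
  eq_of_atom_le b c hbc := by
    obtain ⟨h₁, h₂, -⟩ := sum₃_le_sum₃_iff.1 hbc
    have hK₁ := ClosedSubmodule.bot_ne_top (K := K₁)
    have hK₂ := ClosedSubmodule.bot_ne_top (K := K₂)
    cases b <;> cases c <;> simp_all
  cover := by
    rintro ⟨M, hM⟩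
    obtain ⟨M₁, M₂, M₃, hM₃, rfl, h₁, h₂, h₃⟩ := exists_eq_sum₃_of_mem_invLattice hB₁ hB₂ hM
    by_cases htop : M₁ = ⊤ ∧ M₂ = ⊤
    · obtain ⟨rfl, rfl⟩ := htop
      exact Or.inr (Or.inr ⟨⟨M₃, hM₃⟩, rfl⟩)
    obtain rfl := h₃.resolve_right htop
    rcases h₁ with rfl | rfl <;> rcases h₂ with rfl | rfl
    · exact Or.inl (Subtype.ext sum₃_bot)
    · exact Or.inr (Or.inl ⟨false, rfl⟩)
    · exact Or.inr (Or.inl ⟨true, rfl⟩)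
    · exact absurd ⟨rfl, rfl⟩ htop

/-- Invariance of K₁ and K₂ makes the first two columns diagonal, and invariance of K₁ ⊕ K₂ ⊕ L for
all L in Lat A puts the last diagonal entry in Alg Lat A = A. The other entries are unconstrained.
-/
theorem isReflexiveAlgebra_suspensionAlgebra (hA : IsReflexiveAlgebra A) (hB₁ : ∀ T, T ∈ B₁)
    (hB₂ : ∀ T, T ∈ B₂) : IsReflexiveAlgebra (suspensionAlgebra B₁ B₂ A) := by
  intro T hT
  have hatom (b : Bool) := hT _ (suspensionAtom B₁ B₂ A b).2
  have hupper (L : invLattice A) := hT _ (suspensionUpper B₁ B₂ A L).2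
  let in₁ : K₁ →L[ℂ] HilbertSum₃ K₁ K₂ H := col (ContinuousLinearMap.id ℂ K₁) 0 0
  let in₂ : K₂ →L[ℂ] HilbertSum₃ K₁ K₂ H := col 0 (ContinuousLinearMap.id ℂ K₂) 0
  let in₃ : H →L[ℂ] HilbertSum₃ K₁ K₂ H := col 0 0 (ContinuousLinearMap.id ℂ H)
  refine ⟨proj₁ K₁ K₂ H ∘L T ∘L in₁, hB₁ _, proj₂ K₁ K₂ H ∘L T ∘L in₂, hB₂ _,
    proj₃ K₁ K₂ H ∘L T ∘L in₃, hA _ fun L hL h hh => ?_, proj₁ K₁ K₂ H ∘L T ∘L in₃,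
    proj₂ K₁ K₂ H ∘L T ∘L in₃, fun k₁ k₂ h => ?_⟩
  · exact (hupper ⟨L, hL⟩ (vec₃ 0 0 h) ⟨ClosedSubmodule.mem_top, ClosedSubmodule.mem_top, hh⟩).2.2
  · obtain ⟨l₁, l₂, l₃, hl⟩ := exists_eq_vec₃ (T (vec₃ k₁ 0 0))
    obtain ⟨m₁, m₂, m₃, hm⟩ := exists_eq_vec₃ (T (vec₃ 0 k₂ 0))
    obtain ⟨n₁, n₂, n₃, hn⟩ := exists_eq_vec₃ (T (vec₃ 0 0 h))
    have h₁ := hatom true (vec₃ k₁ 0 0)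
      (vec₃_mem_sum₃.2 ⟨ClosedSubmodule.mem_top, zero_mem _, zero_mem _⟩)
    have h₂ := hatom false (vec₃ 0 k₂ 0)
      (vec₃_mem_sum₃.2 ⟨zero_mem _, ClosedSubmodule.mem_top, zero_mem _⟩)
    rw [hl] at h₁
    rw [hm] at h₂
    obtain ⟨-, hl₂, hl₃⟩ := vec₃_mem_sum₃.1 h₁
    obtain ⟨hm₁, -, hm₃⟩ := vec₃_mem_sum₃.1 h₂
    simp only [cond_true, cond_false, ClosedSubmodule.mem_bot] at hl₂ hl₃ hm₁ hm₃
    rw [vec₃_eq_add, map_add, map_add]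
    simp [in₁, in₂, in₃, hl, hm, hn, ← vec₃_add, hl₂, hl₃, hm₁, hm₃]

theorem invProjectionsCommute_suspensionAlgebra [CompleteSpace H] (hA : InvProjectionsCommute A)
    (hB₁ : ∀ T, T ∈ B₁) (hB₂ : ∀ T, T ∈ B₂) :
    InvProjectionsCommute (suspensionAlgebra B₁ B₂ A) := by
  intro M hM N hN
  obtain ⟨M₁, M₂, M₃, hM₃, rfl, hM₁, hM₂, -⟩ := exists_eq_sum₃_of_mem_invLattice hB₁ hB₂ hM
  obtain ⟨N₁, N₂, N₃, hN₃, rfl, -, -, -⟩ := exists_eq_sum₃_of_mem_invLattice hB₁ hB₂ hN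
  refine commute_starProjection_sum₃ ?_ ?_ (hA _ hM₃ _ hN₃)
  · rcases hM₁ with rfl | rfl <;> simp [Submodule.starProjection_top']
  · rcases hM₂ with rfl | rfl <;> simp [Submodule.starProjection_top']

end SuspensionLattice

end

theorem proposition3p8 {K₁ K₂ H : Type*}
    [NormedAddCommGroup K₁] [InnerProductSpace ℂ K₁] [CompleteSpace K₁]
    [TopologicalSpace.SeparableSpace K₁]
    [NormedAddCommGroup K₂] [InnerProductSpace ℂ K₂] [CompleteSpace K₂]
    [TopologicalSpace.SeparableSpace K₂]
    [NormedAddCommGroup H] [InnerProductSpace ℂ H] [CompleteSpace H]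
    [TopologicalSpace.SeparableSpace H]
    (A : Subalgebra ℂ (H →L[ℂ] H)) (hA : IsCDCSLAlgebra A)
    (B₁ : VonNeumannAlgebra K₁) (hB₁ : IsTypeIFactor B₁)
    (hB₁' : InvProjectionsCommute B₁.toAlgebra)
    (B₂ : VonNeumannAlgebra K₂) (hB₂ : IsTypeIFactor B₂)
    (hB₂' : InvProjectionsCommute B₂.toAlgebra) :
    IsCDCSLAlgebra (suspensionAlgebra B₁ B₂ A) ∧
    (∃ e : TwoPointSuspension (MeetIrr A) ≃o MeetIrr (suspensionAlgebra B₁ B₂ A),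
      IsHomeomorph e) ∧
    ∀ t : ℕ, 1 ≤ t →
      Nonempty (spectralHomology (suspensionAlgebra B₁ B₂ A) (t + 1) ≃ₗ[ℤ] spectralHomology A t) := by
  -- Nonzero K₁ and K₂ are what make the two atoms incomparable.
  have := hB₁.nontrivial
  have := hB₂.nontrivial
  have htop₁ := hB₁.mem_of_commute hB₁'
  have htop₂ := hB₂.mem_of_commute hB₂'
  have h := isLatticeSuspension_suspensionAlgebra (A := A) htop₁ htop₂
  exact ⟨⟨isReflexiveAlgebra_suspensionAlgebra hA.reflexive htop₁ htop₂,
    invProjectionsCommute_suspensionAlgebra hA.commute htop₁ htop₂,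
    h.completelyDistrib hA.completelyDistributive⟩,
    ⟨h.meetIrrOrderIso, h.isHomeomorph_meetIrrOrderIso⟩,
    fun _ ht => nonempty_pointNbhdHomology_equiv h.meetIrrOrderIso
      h.isHomeomorph_meetIrrOrderIso ht⟩
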